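/- All graphs are finite and simple. Paths are meant to be chordless (induced), and the length of a path is its number of edges. A *hole* in a graph is an induced cycle with at least $4$ vertices, and a *square* is a hole of length $4$. A graph *contains* a graph $F$ if some induced subgraph of it is isomorphic to $F$, and it is $F$-free otherwise. - A *theta* is a graph made of three internally vertex-disjoint chordless paths $P_1=a\dots b$, $P_2=a\dots b$, $P_3=a\dots b$ of length at least $2$, with no edges between the paths except the three edges incident with $a$ and the three edges incident with $b$. - A *pyramid* is a graph made of three chordless paths $P_1=a\dots b_1$, $P_2=a\dots b_2$, $P_3=a\dots b_3$ of length at least $1$, two of which have length at least $2$, vertex-disjoint except at $a$, such that $b_1b_2b_3$ is a triangle and no edges exist between the paths except those of the triangle and the three edges incident with $a$. - A *prism* is a graph made of three vertex-disjoint chordless paths $P_1=a_1\dots b_1$, $P_2=a_2\dots b_2$, $P_3=a_3\dots b_3$ of length at least $1$, such that $a_1a_2a_3$ and $b_1b_2b_3$ are triangles and no edges exist between the paths except those of the two triangles. - An *even wheel* is a graph made of a hole and a vertex $v$ not in the hole such that the number of neighbors of $v$ in the hole is even and at least three. Let $\mathcal C$ be the class of (square, prism, pyramid, theta, even wheel)-free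 graphs. For a hole $H$ in a graph $G$ and a vertex $w\notin V(H)$, say that $w$ is *major* with respect to $H$ if the set of neighbors of $w$ in $H$ is not included in a $3$-vertex path of $H$. If $w$ has at least two neighbors in $H$, a *$w$-sector* of $H$ is a path of $H$ of length at least $1$ whose ends are adjacent to $w$ and whose internal vertices are not. Write $N(w)$ for the set of neighbors of $w$, $N[w]=\{w\}\cup N(w)$, and, for a set $D$ of vertices, $N(D)$ for the set of vertices outside $D$ that have at least one neighbor in $D$. **Theorem.** Let $G$ be a graph in $\mathcal C$, let $H$ be a hole in $G$, and let $w$ be a vertex that is major with respect to $H$. Then for every connected component $D$ of $G\setminus N[w]$ there exists a $w$-sector $P=x\dots y$ of $H$ such that $$N(D)\subseteq\{x,y\}\cup\bigl(N(w)\setminus V(H)\bigr).$$ -/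

import Mathlib

namespace SepGraph

variable {V : Type*} (G : SimpleGraph V)

/-- A path in the sense of induced (chordless) paths. -/
def IsIndPath {G : SimpleGraph V} {x y : V} (P : G.Walk x y) : Prop :=
  P.IsPath ∧ P.IsChordless

/-- The set `H` is the vertex set of a hole of `G`, that is, of an induced cycle with at least
four vertices (the hole itself is the subgraph of `G` induced by `H`). -/
def IsHole (H : Set V) : Prop :=
  ∃ (v : V) (c : G.Walk v v),
    c.IsCycle ∧ c.IsChordless ∧ 4 ≤ c.length ∧ H = {x | x ∈ c.support}

/-- The subgraph of `G` induced by `S` is a square (a hole of length `4`). -/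
def InducesSquare (S : Set V) : Prop :=
  IsHole G S ∧ S.ncard = 4

/-- The subgraph of `G` induced by `S` is a theta. Since the paths are chordless, the edges
between two different paths that contain one of `a`, `b` are edges of one of the paths. -/
def InducesTheta (S : Set V) : Prop :=
  ∃ (a b : V) (P : Fin 3 → G.Walk a b),
    (∀ i, IsIndPath (P i) ∧ 2 ≤ (P i).length) ∧
    (∀ i j, i ≠ j → ∀ u ∈ (P i).support, u ∈ (P j).support → u = a ∨ u = b) ∧
    (∀ i j, i ≠ j → ∀ u ∈ (P i).support, ∀ v ∈ (P j).support, G.Adj u v →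
      (u = a ∨ u = b) ∨ (v = a ∨ v = b)) ∧
    S = {v | ∃ i, v ∈ (P i).support}

/-- The subgraph of `G` induced by `S` is a pyramid. Since the paths are chordless, the edges
between two different paths that contain `a` are first edges of the paths. -/
def InducesPyramid (S : Set V) : Prop :=
  ∃ (a : V) (b : Fin 3 → V) (P : ∀ i, G.Walk a (b i)),
    (∀ i, IsIndPath (P i) ∧ 1 ≤ (P i).length) ∧
    (∃ i j, i ≠ j ∧ 2 ≤ (P i).length ∧ 2 ≤ (P j).length) ∧
    (∀ i j, i ≠ j → ∀ u ∈ (P i).support, u ∈ (P j).support → u = a) ∧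
    (∀ i j, i ≠ j → G.Adj (b i) (b j)) ∧
    (∀ i j, i ≠ j → ∀ u ∈ (P i).support, ∀ v ∈ (P j).support, G.Adj u v →
      (u = b i ∧ v = b j) ∨ u = a ∨ v = a) ∧
    S = {v | ∃ i, v ∈ (P i).support}

/-- The subgraph of `G` induced by `S` is a prism. -/
def InducesPrism (S : Set V) : Prop :=
  ∃ (a b : Fin 3 → V) (P : ∀ i, G.Walk (a i) (b i)),
    (∀ i, IsIndPath (P i) ∧ 1 ≤ (P i).length) ∧
    (∀ i j, i ≠ j → ∀ u ∈ (P i).support, u ∉ (P j).support) ∧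
    (∀ i j, i ≠ j → G.Adj (a i) (a j) ∧ G.Adj (b i) (b j)) ∧
    (∀ i j, i ≠ j → ∀ u ∈ (P i).support, ∀ v ∈ (P j).support, G.Adj u v →
      (u = a i ∧ v = a j) ∨ (u = b i ∧ v = b j)) ∧
    S = {v | ∃ i, v ∈ (P i).support}

/-- The subgraph of `G` induced by `S` is an even wheel: a hole (the rim) and one more vertex
(the center) whose number of neighbors in the rim is at least three and even. -/
def InducesEvenWheel (S : Set V) : Prop :=
  ∃ (H : Set V) (v : V),
    IsHole G H ∧ v ∉ H ∧
    3 ≤ (G.neighborSet v ∩ H).ncard ∧ Even (G.neighborSet v ∩ H).ncard ∧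
    S = insert v H

/-- The class of (square, prism, pyramid, theta, even wheel)-free graphs: no induced subgraph
is one of these. -/
def InClassC : Prop :=
  ∀ S : Set V, ¬ InducesSquare G S ∧ ¬ InducesPrism G S ∧ ¬ InducesPyramid G S ∧
    ¬ InducesTheta G S ∧ ¬ InducesEvenWheel G S

/-- `P` is a path of the induced subgraph of `G` with vertex set `H`. -/
def IsPathOf {G : SimpleGraph V} (H : Set V) {x y : V} (P : G.Walk x y) : Prop :=
  IsIndPath P ∧ ∀ v ∈ P.support, v ∈ H

/-- The vertex `w` is major with respect to the hole `H`: it is not in `H` and its set of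
neighbors in `H` is not included in a path of `H` with three vertices. -/
def IsMajor (H : Set V) (w : V) : Prop :=
  w ∉ H ∧ ¬ ∃ (x y : V) (P : G.Walk x y), IsPathOf H P ∧ P.length = 2 ∧
    ∀ v ∈ G.neighborSet w ∩ H, v ∈ P.support

/-- `P` is a `w`-sector of the hole `H`: a path of `H` of length at least one whose ends are
adjacent to `w` and whose internal vertices are not. -/
def IsSector {G : SimpleGraph V} (H : Set V) (w : V) {x y : V} (P : G.Walk x y) : Prop :=
  IsPathOf H P ∧ 1 ≤ P.length ∧ G.Adj w x ∧ G.Adj w y ∧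
    ∀ v ∈ P.support, v ≠ x → v ≠ y → ¬ G.Adj w v

/-- The closed neighborhood `N[w]`. -/
def closedNbhd (w : V) : Set V :=
  insert w (G.neighborSet w)

/-- `N(A)`: the vertices outside `A` that have a neighbor in `A`. -/
def nbhd (A : Set V) : Set V :=
  {v | v ∉ A ∧ ∃ u ∈ A, G.Adj v u}

end SepGraph

/-! Let K be the number of neighbors of w in H. The excluded thetas, pyramids and even wheels force
K to be odd and at least 3, and the neighbors to be pairwise nonadjacent when K = 3
(`wheel_of_major`). Two tools follow. Parity: H cannot be rerouted along a path of G \ N[w] so as to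
bypass exactly one neighbor of w. The new hole would contain K - 1 of them, an even number: at least
four give an even wheel, and two give a theta because they are nonadjacent (`bypass_false`).
Linking: w closes a sector of length at least 2 into a hole. A connected set that meets this hole's
neighborhood through a vertex u, and reaches w through the far part of H, creates a theta or a
pyramid, unless u sees exactly one end of the sector and nothing else of it (`link_false`,
`far_false`).

The core is that an induced path of G \ N[w] attaches to a single sector, its own vertices on H
being counted as well (`inSector_of_path`). The proof is by induction on the length; single vertices
are the base case (`sector_of_vertex`). In a minimal failure Q = p … q, the attachments of Q - q lie
in one sector and those of Q - p in another (`Crossing`). If the two sectors share an end, Q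
bypasses it. If they are disjoint, only p and q attach to H. Linking excludes an end of Q with just
one neighbor in H, and then forces both sectors to be edges, complete to p and to q respectively; H
and Q form a prism.

For a component D, two of its vertices are joined by an induced path in D, so any two vertices of
N(D) in H are ends of a common sector. This pairwise statement fails to give one sector for all only
if K = 3 and D is attached to all three neighbors of w. The sectors are then long, and D meets the
interior of two of them, since otherwise there is a theta; a path of D between these interiors
contradicts the core statement. Vertices of N(D) outside H lie in N(w) because D is a component. -/

namespace SepGraph

open SimpleGraph

variable {V : Type*} {G : SimpleGraph V}

/-! ### Walks inside a set and induced paths -/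

/-- `u` and `v` are joined by a walk inside the set `X`. -/
def Reach (G : SimpleGraph V) (X : Set V) (u v : V) : Prop :=
  ∃ p : G.Walk u v, ∀ x ∈ p.support, x ∈ X

lemma Reach.refl {X : Set V} {u : V} (h : u ∈ X) : Reach G X u u :=
  ⟨.nil, by simpa using h⟩

lemma Reach.symm {X : Set V} {u v : V} (h : Reach G X u v) : Reach G X v u := by
  obtain ⟨p, hp⟩ := h
  exact ⟨p.reverse, by simpa using hp⟩

lemma Reach.trans {X : Set V} {u v t : V} (h : Reach G X u v) (h' : Reach G X v t) :
    Reach G X u t := by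
  obtain ⟨p, hp⟩ := h
  obtain ⟨q, hq⟩ := h'
  refine ⟨p.append q, fun x hx => ?_⟩
  rcases (Walk.mem_support_append_iff _ _).1 hx with h | h
  exacts [hp x h, hq x h]

lemma Reach.mono {X Y : Set V} {u v : V} (h : Reach G X u v) (hXY : X ⊆ Y) : Reach G Y u v := by
  obtain ⟨p, hp⟩ := h
  exact ⟨p, fun x hx => hXY (hp x hx)⟩

lemma Reach.of_adj {X : Set V} {u v : V} (h : G.Adj u v) (hu : u ∈ X) (hv : v ∈ X) :
    Reach G X u v :=
  ⟨.cons h .nil, by simp [hu, hv]⟩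

lemma isIndPath_nil {u : V} : IsIndPath (.nil : G.Walk u u) := by
  refine ⟨by simp, Walk.isChordless_iff_forall_mem_edges.2 ?_⟩
  intro a b ha hb hab
  simp only [Walk.support_nil, List.mem_singleton] at ha hb
  subst ha hb
  exact absurd hab (G.loopless.irrefl _)

lemma isIndPath_cons {u v t : V} (h : G.Adj u v) (p : G.Walk v t) :
    IsIndPath (.cons h p) ↔
      IsIndPath p ∧ u ∉ p.support ∧ ∀ x ∈ p.support, G.Adj u x → x = v := by
  constructor
  · rintro ⟨hp, hc⟩
    rw [Walk.cons_isPath_iff] at hp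
    rw [Walk.isChordless_iff_forall_mem_edges] at hc
    refine ⟨⟨hp.1, Walk.isChordless_iff_forall_mem_edges.2 fun a b ha hb hab => ?_⟩, hp.2, ?_⟩
    · have := hc (u' := a) (v' := b) (by simp [ha]) (by simp [hb]) hab
      rw [Walk.edges_cons, List.mem_cons] at this
      rcases this with h1 | h1
      · rcases Sym2.eq_iff.1 h1 with ⟨rfl, rfl⟩ | ⟨rfl, rfl⟩
        exacts [absurd ha hp.2, absurd hb hp.2]
      · exact h1
    · intro x hx hux
      have := hc (u' := u) (v' := x) (by simp) (by simp [hx]) hux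
      rw [Walk.edges_cons, List.mem_cons] at this
      rcases this with h1 | h1
      · rcases Sym2.eq_iff.1 h1 with ⟨_, rfl⟩ | ⟨rfl, rfl⟩
        · rfl
        · exact absurd hx hp.2
      · exact absurd (Walk.fst_mem_support_of_mem_edges _ h1) hp.2
  · rintro ⟨⟨hp, hc⟩, hu, hx⟩
    rw [Walk.isChordless_iff_forall_mem_edges] at hc
    refine ⟨(Walk.cons_isPath_iff _ _).2 ⟨hp, hu⟩, Walk.isChordless_iff_forall_mem_edges.2 ?_⟩
    intro a b ha hb hab
    rw [Walk.support_cons, List.mem_cons] at ha hb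
    rw [Walk.edges_cons, List.mem_cons]
    rcases ha with rfl | ha <;> rcases hb with rfl | hb
    · exact absurd hab (G.loopless.irrefl _)
    · left; rw [hx b hb hab]
    · left; rw [hx a ha hab.symm, Sym2.eq_swap]
    · exact Or.inr (hc ha hb hab)

lemma IsIndPath.reverse {u v : V} {p : G.Walk u v} (h : IsIndPath p) : IsIndPath p.reverse := by
  refine ⟨h.1.reverse, Walk.isChordless_iff_forall_mem_edges.2 fun a b ha hb hab => ?_⟩
  rw [Walk.edges_reverse, List.mem_reverse]
  exact h.2.mem_edges (by simpa using ha) (by simpa using hb) hab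

/-- Jump from `u` directly to the last vertex of `q` that equals `u` or is adjacent to it; nothing
later on `q` can create a chord. The induction finds this vertex by trying the tail first. -/
lemma exists_indPath_of_attached {v t : V} (q : G.Walk v t) (hq : IsIndPath q) (u : V)
    (hu : ∃ x ∈ q.support, x = u ∨ G.Adj u x) :
    ∃ r : G.Walk u t, IsIndPath r ∧ ∀ x ∈ r.support, x = u ∨ x ∈ q.support := by
  induction q with
  | @nil a =>
    obtain ⟨x, hx, h⟩ := hu
    simp only [Walk.support_nil, List.mem_singleton] at hx
    subst hx
    rcases h with rfl | h
    · exact ⟨.nil, isIndPath_nil, by simp⟩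
    · refine ⟨.cons h .nil, (isIndPath_cons _ _).2 ⟨isIndPath_nil, ?_, ?_⟩, ?_⟩
      · simpa using h.ne
      · simp
      · simp
  | @cons a b c h q ih =>
    rw [isIndPath_cons] at hq
    by_cases h1 : ∃ x ∈ q.support, x = u ∨ G.Adj u x
    · obtain ⟨r, hr, hs⟩ := ih hq.1 h1
      refine ⟨r, hr, fun x hx => ?_⟩
      rcases hs x hx with h | h
      · exact Or.inl h
      · exact Or.inr (by simp [h])
    · push Not at h1
      by_cases hua : a = u
      · subst hua
        exact ⟨.cons h q, (isIndPath_cons _ _).2 hq, fun x hx => Or.inr hx⟩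
      · obtain ⟨x, hx, h2⟩ := hu
        rw [Walk.support_cons, List.mem_cons] at hx
        have hxa : x = a := by
          rcases hx with hx | hx
          · exact hx
          · rcases h2 with h2 | h2
            · exact absurd h2 (h1 x hx).1
            · exact absurd h2 (h1 x hx).2
        subst hxa
        have hux : G.Adj u x := h2.resolve_left hua
        refine ⟨.cons hux (.cons h q), (isIndPath_cons _ _).2
          ⟨(isIndPath_cons _ _).2 hq, ?_, ?_⟩, ?_⟩
        · rw [Walk.support_cons, List.mem_cons, not_or]
          exact ⟨fun e => hua e.symm, fun e => (h1 u e).1 rfl⟩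
        · intro y hy huy
          rw [Walk.support_cons, List.mem_cons] at hy
          rcases hy with hy | hy
          · exact hy
          · exact absurd huy (h1 y hy).2
        · intro y hy
          rw [Walk.support_cons, List.mem_cons] at hy
          exact hy

lemma Reach.exists_indPath {X : Set V} {u v : V} (h : Reach G X u v) :
    ∃ p : G.Walk u v, IsIndPath p ∧ ∀ x ∈ p.support, x ∈ X := by
  obtain ⟨p, hp⟩ := h
  induction p with
  | nil => exact ⟨.nil, isIndPath_nil, hp⟩
  | @cons a b c hab p ih =>
    obtain ⟨q, hq, hqX⟩ := ih fun x hx => hp x (by simp [hx])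
    obtain ⟨r, hr, hrX⟩ := exists_indPath_of_attached q hq a ⟨b, by simp, Or.inr hab⟩
    refine ⟨r, hr, fun x hx => ?_⟩
    rcases hrX x hx with rfl | h
    · exact hp _ (by simp)
    · exact hqX x h

/-! ### Integer parametrizations of paths and holes -/

/-- On the integer interval `[i, j]` the map `f` parametrizes an induced path. -/
def LinearOn (G : SimpleGraph V) (f : ℤ → V) (i j : ℤ) : Prop :=
  ∀ s t, i ≤ s → s < t → t ≤ j → f s ≠ f t ∧ (G.Adj (f s) (f t) ↔ t = s + 1)

lemma LinearOn.mono {f : ℤ → V} {i j i' j' : ℤ} (h : LinearOn G f i j) (hi : i ≤ i')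
    (hj : j' ≤ j) : LinearOn G f i' j' :=
  fun s t hs hst ht => h s t (by omega) hst (by omega)

lemma LinearOn.exists_walk {f : ℤ → V} {i j : ℤ} (h : LinearOn G f i j) (hij : i ≤ j) :
    ∃ p : G.Walk (f i) (f j), IsIndPath p ∧ (p.length : ℤ) = j - i ∧
      ∀ v, v ∈ p.support ↔ ∃ m, i ≤ m ∧ m ≤ j ∧ f m = v := by
  obtain ⟨n, hn⟩ := Int.eq_ofNat_of_zero_le (show 0 ≤ j - i by omega)
  induction n generalizing i with
  | zero =>
    obtain rfl : i = j := by omega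
    refine ⟨.nil, isIndPath_nil, by simp, fun v => ?_⟩
    simp only [Walk.support_nil, List.mem_singleton]
    constructor
    · rintro rfl
      exact ⟨i, le_rfl, le_rfl, rfl⟩
    · rintro ⟨m, h1, h2, rfl⟩
      rw [show m = i by omega]
  | succ n ih =>
    push_cast at hn
    obtain ⟨p, hp, hl, hs⟩ := ih (h.mono (i' := i + 1) (by omega) le_rfl) (by omega)
      (by omega)
    have hadj : G.Adj (f i) (f (i + 1)) := (h i (i + 1) le_rfl (by omega) (by omega)).2.2 rfl
    refine ⟨.cons hadj p, (isIndPath_cons _ _).2 ⟨hp, ?_, ?_⟩, ?_, ?_⟩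
    · rw [hs]
      rintro ⟨m, h1, h2, h3⟩
      exact (h i m le_rfl (by omega) h2).1 h3.symm
    · intro x hx hix
      obtain ⟨m, h1, h2, rfl⟩ := (hs x).1 hx
      rw [((h i m le_rfl (by omega) h2).2.1 hix)]
    · rw [Walk.length_cons]; push_cast; omega
    · intro v
      rw [Walk.support_cons, List.mem_cons, hs]
      constructor
      · rintro (rfl | ⟨m, h1, h2, rfl⟩)
        · exact ⟨i, le_rfl, hij, rfl⟩
        · exact ⟨m, by omega, h2, rfl⟩
      · rintro ⟨m, h1, h2, rfl⟩
        rcases eq_or_lt_of_le h1 with rfl | h1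
        · exact Or.inl rfl
        · exact Or.inr ⟨m, by omega, h2, rfl⟩

lemma LinearOn.reach {f : ℤ → V} {i j s t : ℤ} (h : LinearOn G f i j) {X : Set V}
    (hX : ∀ m, i ≤ m → m ≤ j → f m ∈ X) (hs : i ≤ s) (hs' : s ≤ j) (ht : i ≤ t) (ht' : t ≤ j) :
    Reach G X (f s) (f t) := by
  wlog hst : s ≤ t generalizing s t
  · exact (this ht ht' hs hs' (by omega)).symm
  obtain ⟨p, -, -, hp⟩ := (h.mono hs ht').exists_walk hst
  refine ⟨p, fun x hx => ?_⟩
  obtain ⟨m, h1, h2, rfl⟩ := (hp x).1 hx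
  exact hX m (by omega) (by omega)

/-- The cycle has `P.length + R.length + 2` edges, so the length bound is exactly what four vertices
require; either path may be a single vertex. -/
lemma isHole_of_paths {a b c d : V} {P : G.Walk a b} {R : G.Walk c d} (hP : IsIndPath P)
    (hR : IsIndPath R) (hbc : G.Adj b c) (hda : G.Adj d a)
    (hPR : ∀ x ∈ P.support, ∀ y ∈ R.support,
      x ≠ y ∧ (G.Adj x y → (x = b ∧ y = c) ∨ (x = a ∧ y = d)))
    (hlen : 2 ≤ P.length + R.length) :
    IsHole G ({x | x ∈ P.support} ∪ {x | x ∈ R.support}) := by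
  have hpath : (P.append (.cons hbc R)).IsPath := by
    rw [Walk.isPath_def, Walk.support_append, Walk.support_cons, List.tail_cons,
      List.nodup_append]
    exact ⟨hP.1.support_nodup, hR.1.support_nodup, fun x hx y hy => (hPR x hx y hy).1⟩
  have hmem : ∀ x, x ∈ (P.append (.cons hbc R)).support ↔ x ∈ P.support ∨ x ∈ R.support := by
    intro x
    rw [Walk.support_append, Walk.support_cons, List.tail_cons, List.mem_append]
  have hedge : ∀ e, e ∈ (P.append (.cons hbc R)).edges ↔
      e ∈ P.edges ∨ e = s(b, c) ∨ e ∈ R.edges := by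
    intro e
    rw [Walk.edges_append, Walk.edges_cons, List.mem_append, List.mem_cons]
  refine ⟨d, .cons hda (P.append (.cons hbc R)), ?_, ?_, ?_, ?_⟩
  · rw [Walk.cons_isCycle_iff, hedge]
    refine ⟨hpath, ?_⟩
    rintro (h | h | h)
    · exact (hPR _ (Walk.fst_mem_support_of_mem_edges _ h) d (by simp)).1 rfl
    · rcases Sym2.eq_iff.1 h with ⟨rfl, rfl⟩ | ⟨rfl, rfl⟩
      · exact (hPR d (by simp) d (by simp)).1 rfl
      · have h1 := Walk.length_eq_zero_iff.2 (Walk.isPath_iff_nil.1 hP.1)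
        have h2 := Walk.length_eq_zero_iff.2 (Walk.isPath_iff_nil.1 hR.1)
        omega
    · exact (hPR a (by simp) _ (Walk.snd_mem_support_of_mem_edges _ h)).1 rfl
  · rw [Walk.isChordless_iff_forall_mem_edges]
    have key : ∀ x y, x ∈ P.support → y ∈ R.support → G.Adj x y →
        s(x, y) ∈ (Walk.cons hda (P.append (.cons hbc R))).edges := by
      intro x y hx hy hxy
      rw [Walk.edges_cons, List.mem_cons, hedge]
      rcases (hPR x hx y hy).2 hxy with ⟨rfl, rfl⟩ | ⟨rfl, rfl⟩
      · exact Or.inr (Or.inr (Or.inl rfl))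
      · exact Or.inl Sym2.eq_swap
    have hmem' : ∀ x, x ∈ (Walk.cons hda (P.append (.cons hbc R))).support →
        x ∈ P.support ∨ x ∈ R.support := by
      intro x hx
      rw [Walk.support_cons, List.mem_cons, hmem] at hx
      rcases hx with rfl | hx
      · exact Or.inr (by simp)
      · exact hx
    intro x y hx hy hxy
    rcases hmem' x hx with hx | hx <;> rcases hmem' y hy with hy | hy
    · rw [Walk.edges_cons, List.mem_cons, hedge]
      exact Or.inr (Or.inl (hP.2.mem_edges hx hy hxy))
    · exact key x y hx hy hxy
    · rw [Sym2.eq_swap]; exact key y x hy hx hxy.symm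
    · rw [Walk.edges_cons, List.mem_cons, hedge]
      exact Or.inr (Or.inr (Or.inr (hR.2.mem_edges hx hy hxy)))
  · rw [Walk.length_cons, Walk.length_append, Walk.length_cons]; omega
  · ext x
    simp only [Set.mem_union, Set.mem_ofPred_eq, Walk.support_cons, List.mem_cons, hmem]
    constructor
    · exact Or.inr
    · rintro (rfl | h)
      · exact Or.inr (by simp)
      · exact h

/-- A periodic parametrization, with period `N`, of an induced cycle of length `N`. -/
structure Ring (G : SimpleGraph V) (f : ℤ → V) (N : ℤ) : Prop where
  four_le : 4 ≤ N
  per : ∀ i, f (i + N) = f i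
  adj : ∀ i j, i < j → j < i + N → f i ≠ f j ∧ (G.Adj (f i) (f j) ↔ j = i + 1 ∨ j + 1 = i + N)

/-- The bound says that the arc omits at least one vertex of the hole, so its ends are not joined by
the closing edge. -/
lemma Ring.linearOn {f : ℤ → V} {N i j : ℤ} (h : Ring G f N) (hij : j + 2 ≤ i + N) :
    LinearOn G f i j := by
  intro s t hs hst ht
  obtain ⟨h1, h2⟩ := h.adj s t hst (by omega)
  refine ⟨h1, h2.trans ⟨?_, ?_⟩⟩ <;> omega

lemma Ring.per_mul {f : ℤ → V} {N : ℤ} (h : Ring G f N) (i k : ℤ) : f (i + N * k) = f i := by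
  induction k using Int.induction_on with
  | zero => simp
  | succ k ih => rw [mul_add, mul_one, ← add_assoc, h.per, ih]
  | pred k ih => rw [← h.per, ← ih]; congr 1; ring

/-- Moving indices into a chosen window of `N` consecutive integers, on which `f` is injective,
turns cyclic order into linear inequalities. -/
lemma Ring.exists_rep {f : ℤ → V} {N : ℤ} (h : Ring G f N) (c m : ℤ) :
    ∃ m' k, c ≤ m' ∧ m' < c + N ∧ f m' = f m ∧ m = m' + N * k := by
  have h4 := h.four_le
  have h0 : 0 < N := by omega
  refine ⟨c + (m - c) % N, (m - c) / N, ?_, ?_, ?_, ?_⟩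
  · have := Int.emod_nonneg (m - c) h0.ne'; omega
  · have := Int.emod_lt_of_pos (m - c) h0; omega
  · have h1 := Int.emod_add_mul_ediv (m - c) N
    rw [← h.per_mul _ ((m - c) / N)]; congr 1; omega
  · have h1 := Int.emod_add_mul_ediv (m - c) N
    omega

lemma Ring.inj {f : ℤ → V} {N s t c : ℤ} (h : Ring G f N) (hs : c ≤ s) (hs' : s < c + N)
    (ht : c ≤ t) (ht' : t < c + N) (hst : f s = f t) : s = t := by
  rcases lt_trichotomy s t with h1 | h1 | h1
  · exact absurd hst (h.adj s t h1 (by omega)).1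
  · exact h1
  · exact absurd hst.symm (h.adj t s h1 (by omega)).1

lemma Ring.reflect {f : ℤ → V} {N : ℤ} (h : Ring G f N) : Ring G (fun i => f (-i)) N := by
  refine ⟨h.four_le, fun i => ?_, fun i j hij hj => ?_⟩
  · rw [← h.per]; congr 1; ring
  · obtain ⟨h1, h2⟩ := h.adj (-j) (-i) (by omega) (by omega)
    refine ⟨h1.symm, ?_⟩
    rw [G.adj_comm, h2]
    omega

lemma IsHole.exists_ring {H : Set V} (hH : IsHole G H) :
    ∃ (f : ℤ → V) (N : ℤ), Ring G f N ∧ H = Set.range f := by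
  obtain ⟨v, c, hc, hch, h4, rfl⟩ := hH
  set n := c.length with hn
  have hinj : ∀ a b : ℕ, a < n → b < n → c.getVert a = c.getVert b → a = b := by
    intro a b ha hb hab
    exact hc.getVert_injOn' (by simp only [Set.mem_ofPred_eq]; omega)
      (by simp only [Set.mem_ofPred_eq]; omega) hab
  have hn0 : c.getVert n = c.getVert 0 := by simp [hn]
  have hadj : ∀ a b : ℕ, a < b → b < n →
      (G.Adj (c.getVert a) (c.getVert b) ↔ b = a + 1 ∨ b + 1 = a + n) := by
    intro a b hab hb
    constructor
    · intro h
      have := hch.mem_edges (c.getVert_mem_support a) (c.getVert_mem_support b) h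
      rw [Walk.mk_mem_edges_iff_exists] at this
      obtain ⟨i, hi, hsym⟩ := this
      have hi1 : ∃ i', i' < n ∧ c.getVert (i + 1) = c.getVert i' ∧
          (i' = i + 1 ∨ i + 1 = n ∧ i' = 0) := by
        by_cases h : i + 1 < n
        · exact ⟨i + 1, h, rfl, Or.inl rfl⟩
        · refine ⟨0, by omega, ?_, Or.inr ⟨by omega, rfl⟩⟩
          rw [show i + 1 = n by omega, hn0]
      obtain ⟨i', hi', he, hcase⟩ := hi1
      rw [he] at hsym
      rcases Sym2.eq_iff.1 hsym with ⟨h1, h2⟩ | ⟨h1, h2⟩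
      · have := hinj _ _ (by omega) (by omega) h1
        have := hinj _ _ (by omega) (by omega) h2
        omega
      · have := hinj _ _ (by omega) (by omega) h1
        have := hinj _ _ (by omega) (by omega) h2
        omega
    · rintro (rfl | h)
      · exact c.adj_getVert_succ (by omega)
      · obtain rfl : a = 0 := by omega
        have := c.adj_getVert_succ (i := b) (by omega)
        rw [show b + 1 = n by omega, hn0] at this
        exact this.symm
  refine ⟨fun i => c.getVert (i % n).toNat, n, ⟨by exact_mod_cast h4, ?_, ?_⟩, ?_⟩
  · intro i; simp
  · intro i j hij hj
    have hn1 : (0 : ℤ) < n := by omega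
    obtain ⟨p, hp⟩ := Int.eq_ofNat_of_zero_le (Int.emod_nonneg i hn1.ne')
    obtain ⟨q, hq⟩ := Int.eq_ofNat_of_zero_le (Int.emod_nonneg j hn1.ne')
    have hp1 := Int.emod_lt_of_pos i hn1
    have hq1 := Int.emod_lt_of_pos j hn1
    have hi := Int.emod_add_mul_ediv i n
    have hj' := Int.emod_add_mul_ediv j n
    simp only [hp, hq, Int.toNat_natCast]
    rw [hp] at hp1 hi
    rw [hq] at hq1 hj'
    -- Since i < j < i + n, the two indices lie in the same block of length n or in consecutive
    -- blocks.
    have hk : j / n = i / n ∨ j / n = i / n + 1 := by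
      have h1 : j / n < i / n + 2 := by
        by_contra hcon
        have := mul_le_mul_of_nonneg_left (show i / n + 2 ≤ j / n by omega) hn1.le
        rw [mul_add] at this
        omega
      have h2 : i / n ≤ j / n := Int.ediv_le_ediv hn1 hij.le
      omega
    rcases hk with hk | hk
    · rw [hk] at hj'
      have hpq : p < q := by omega
      refine ⟨fun e => ?_, ?_⟩
      · have := hinj _ _ (by omega) (by omega) e; omega
      · rw [hadj p q hpq (by omega)]; omega
    · rw [hk, mul_add, mul_one] at hj'
      have hpq : q < p := by omega
      refine ⟨fun e => ?_, ?_⟩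
      · have := hinj _ _ (by omega) (by omega) e; omega
      · rw [G.adj_comm, hadj q p hpq (by omega)]; omega
  · ext x
    simp only [Set.mem_ofPred_eq, Set.mem_range]
    rw [Walk.mem_support_iff_exists_getVert]
    constructor
    · rintro ⟨m, rfl, hm⟩
      by_cases h : m < n
      · refine ⟨m, ?_⟩
        rw [Int.emod_eq_of_lt (by omega) (by omega)]; simp
      · refine ⟨0, ?_⟩
        rw [show m = n by omega, hn0]; simp
    · rintro ⟨y, rfl⟩
      refine ⟨_, rfl, ?_⟩
      have := Int.emod_lt_of_pos y (show (0 : ℤ) < n by omega)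
      omega

/-! ### Forbidden configurations from connected sets -/

/-- The sets `X` and `Y` are disjoint and there are no edges between them. -/
def Anti (G : SimpleGraph V) (X Y : Set V) : Prop :=
  ∀ u ∈ X, ∀ v ∈ Y, u ≠ v ∧ ¬ G.Adj u v

lemma Anti.symm {X Y : Set V} (h : Anti G X Y) : Anti G Y X :=
  fun u hu v hv => ⟨(h v hv u hu).1.symm, fun e => (h v hv u hu).2 e.symm⟩

lemma exists_forall_fin_three {α : Fin 3 → Sort*} {p : ∀ i, α i → Prop} (h0 : ∃ x, p 0 x)
    (h1 : ∃ x, p 1 x) (h2 : ∃ x, p 2 x) : ∀ i, ∃ x, p i x := by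
  intro i
  fin_cases i
  exacts [h0, h1, h2]

lemma forall_ne_fin_three {p : Fin 3 → Fin 3 → Prop} (hs : ∀ i j, p i j → p j i) (h01 : p 0 1)
    (h02 : p 0 2) (h12 : p 1 2) : ∀ i j, i ≠ j → p i j := by
  intro i j hij
  fin_cases i <;> fin_cases j <;> first | exact absurd rfl hij | assumption | (apply hs; assumption)

lemma length_two_le {u v : V} (p : G.Walk u v) (hne : u ≠ v) (hadj : ¬ G.Adj u v) :
    2 ≤ p.length := by
  cases p with
  | nil => exact absurd rfl hne
  | cons h q =>
    cases q with
    | nil => exact absurd h hadj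
    | cons => simp

lemma length_one_le {u v : V} (p : G.Walk u v) (hne : u ≠ v) : 1 ≤ p.length := by
  cases p with
  | nil => exact absurd rfl hne
  | cons h q => simp

/-- Three pairwise anticomplete sets, each linking `a` and `b`, give a theta. -/
lemma theta_false (hG : InClassC G) {a b : V} (hne : a ≠ b) (hadj : ¬ G.Adj a b)
    {X Y Z : Set V} (hXY : Anti G X Y) (hXZ : Anti G X Z) (hYZ : Anti G Y Z)
    (hX : Reach G (insert a (insert b X)) a b) (hY : Reach G (insert a (insert b Y)) a b)
    (hZ : Reach G (insert a (insert b Z)) a b) : False := by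
  let S : Fin 3 → Set V := ![X, Y, Z]
  have hS : ∀ i j, i ≠ j → Anti G (S i) (S j) :=
    forall_ne_fin_three (fun _ _ h => h.symm) hXY hXZ hYZ
  have hP : ∀ i, ∃ p : G.Walk a b, IsIndPath p ∧ ∀ x ∈ p.support, x ∈ insert a (insert b (S i)) :=
    exists_forall_fin_three hX.exists_indPath hY.exists_indPath hZ.exists_indPath
  choose P hP hPS using hP
  refine (hG {v | ∃ i, v ∈ (P i).support}).2.2.2.1 ⟨a, b, P, fun i => ⟨hP i, ?_⟩, ?_, ?_, rfl⟩
  · exact length_two_le _ hne hadj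
  · intro i j hij u hu hu'
    rcases hPS i u hu with h | h | h
    · exact Or.inl h
    · exact Or.inr h
    rcases hPS j u hu' with h' | h' | h'
    · exact Or.inl h'
    · exact Or.inr h'
    exact absurd rfl (hS i j hij u h u h').1
  · intro i j hij u hu v hv huv
    rcases hPS i u hu with h | h | h
    · exact Or.inl (Or.inl h)
    · exact Or.inl (Or.inr h)
    rcases hPS j v hv with h' | h' | h'
    · exact Or.inr (Or.inl h')
    · exact Or.inr (Or.inr h')
    exact absurd huv (hS i j hij u h v h').2

/-- Three disjoint sets, with no edges between them except those of the triangle `b₁ b₂ b₃`, each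
linking `a` to one vertex of the triangle, give a pyramid. -/
lemma pyramid_false (hG : InClassC G) {a b₁ b₂ b₃ : V} {X Y Z : Set V}
    (h₁ : b₁ ∈ X) (h₂ : b₂ ∈ Y) (h₃ : b₃ ∈ Z) (haX : a ∉ X) (haY : a ∉ Y) (haZ : a ∉ Z)
    (h12 : G.Adj b₁ b₂) (h13 : G.Adj b₁ b₃) (h23 : G.Adj b₂ b₃)
    (hXY : ∀ u ∈ X, ∀ v ∈ Y, u ≠ v ∧ (G.Adj u v → u = b₁ ∧ v = b₂))
    (hXZ : ∀ u ∈ X, ∀ v ∈ Z, u ≠ v ∧ (G.Adj u v → u = b₁ ∧ v = b₃))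
    (hYZ : ∀ u ∈ Y, ∀ v ∈ Z, u ≠ v ∧ (G.Adj u v → u = b₂ ∧ v = b₃))
    (hX : Reach G (insert a X) a b₁) (hY : Reach G (insert a Y) a b₂)
    (hZ : Reach G (insert a Z) a b₃)
    (hlen : (¬ G.Adj a b₁ ∧ ¬ G.Adj a b₂) ∨ (¬ G.Adj a b₁ ∧ ¬ G.Adj a b₃) ∨
      (¬ G.Adj a b₂ ∧ ¬ G.Adj a b₃)) : False := by
  let S : Fin 3 → Set V := ![X, Y, Z]
  let b : Fin 3 → V := ![b₁, b₂, b₃]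
  have hS : ∀ i j, i ≠ j → ∀ u ∈ S i, ∀ v ∈ S j, u ≠ v ∧ (G.Adj u v → u = b i ∧ v = b j) := by
    refine forall_ne_fin_three (fun i j h u hu v hv => ?_) hXY hXZ hYZ
    exact ⟨(h v hv u hu).1.symm, fun e => ((h v hv u hu).2 e.symm).symm⟩
  have hb : ∀ i j, i ≠ j → G.Adj (b i) (b j) :=
    forall_ne_fin_three (fun _ _ h => h.symm) h12 h13 h23
  have hP : ∀ i, ∃ p : G.Walk a (b i), IsIndPath p ∧ ∀ x ∈ p.support, x ∈ insert a (S i) :=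
    exists_forall_fin_three hX.exists_indPath hY.exists_indPath hZ.exists_indPath
  choose P hP hPS using hP
  have hab : ∀ i, a ≠ b i := by
    intro i
    fin_cases i
    · rintro rfl; exact haX h₁
    · rintro rfl; exact haY h₂
    · rintro rfl; exact haZ h₃
  refine (hG {v | ∃ i, v ∈ (P i).support}).2.2.1 ⟨a, b, P, fun i => ⟨hP i, ?_⟩, ?_, ?_, hb, ?_, rfl⟩
  · exact length_one_le _ (hab i)
  · rcases hlen with h | h | h
    · exact ⟨0, 1, by decide, length_two_le _ (hab 0) h.1, length_two_le _ (hab 1) h.2⟩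
    · exact ⟨0, 2, by decide, length_two_le _ (hab 0) h.1, length_two_le _ (hab 2) h.2⟩
    · exact ⟨1, 2, by decide, length_two_le _ (hab 1) h.1, length_two_le _ (hab 2) h.2⟩
  · intro i j hij u hu hu'
    rcases hPS i u hu with h | h
    · exact h
    rcases hPS j u hu' with h' | h'
    · exact h'
    exact absurd rfl (hS i j hij u h u h').1
  · intro i j hij u hu v hv huv
    rcases hPS i u hu with h | h
    · exact Or.inr (Or.inl h)
    rcases hPS j v hv with h' | h'
    · exact Or.inr (Or.inr h')
    exact Or.inl ((hS i j hij u h v h').2 huv)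

/-- Three disjoint sets, with no edges between them except those of the triangles `a₁ a₂ a₃` and
`b₁ b₂ b₃`, each linking a vertex of one triangle to one of the other, give a prism. -/
lemma prism_false (hG : InClassC G) {a₁ a₂ a₃ b₁ b₂ b₃ : V} {X Y Z : Set V}
    (h₁ : a₁ ≠ b₁) (h₂ : a₂ ≠ b₂) (h₃ : a₃ ≠ b₃)
    (ha12 : G.Adj a₁ a₂) (ha13 : G.Adj a₁ a₃) (ha23 : G.Adj a₂ a₃)
    (h12 : G.Adj b₁ b₂) (h13 : G.Adj b₁ b₃) (h23 : G.Adj b₂ b₃)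
    (hXY : ∀ u ∈ X, ∀ v ∈ Y, u ≠ v ∧ (G.Adj u v → (u = a₁ ∧ v = a₂) ∨ (u = b₁ ∧ v = b₂)))
    (hXZ : ∀ u ∈ X, ∀ v ∈ Z, u ≠ v ∧ (G.Adj u v → (u = a₁ ∧ v = a₃) ∨ (u = b₁ ∧ v = b₃)))
    (hYZ : ∀ u ∈ Y, ∀ v ∈ Z, u ≠ v ∧ (G.Adj u v → (u = a₂ ∧ v = a₃) ∨ (u = b₂ ∧ v = b₃)))
    (hX : Reach G X a₁ b₁) (hY : Reach G Y a₂ b₂) (hZ : Reach G Z a₃ b₃) : False := by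
  let S : Fin 3 → Set V := ![X, Y, Z]
  let a : Fin 3 → V := ![a₁, a₂, a₃]
  let b : Fin 3 → V := ![b₁, b₂, b₃]
  have hS : ∀ i j, i ≠ j → ∀ u ∈ S i, ∀ v ∈ S j,
      u ≠ v ∧ (G.Adj u v → (u = a i ∧ v = a j) ∨ (u = b i ∧ v = b j)) := by
    refine forall_ne_fin_three (fun i j h u hu v hv => ?_) hXY hXZ hYZ
    exact ⟨(h v hv u hu).1.symm, fun e => ((h v hv u hu).2 e.symm).imp And.symm And.symm⟩
  have hab : ∀ i j, i ≠ j → G.Adj (a i) (a j) ∧ G.Adj (b i) (b j) :=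
    forall_ne_fin_three (fun _ _ h => ⟨h.1.symm, h.2.symm⟩) ⟨ha12, h12⟩ ⟨ha13, h13⟩ ⟨ha23, h23⟩
  have hP : ∀ i, ∃ p : G.Walk (a i) (b i), IsIndPath p ∧ ∀ x ∈ p.support, x ∈ S i :=
    exists_forall_fin_three hX.exists_indPath hY.exists_indPath hZ.exists_indPath
  choose P hP hPS using hP
  have hne : ∀ i, a i ≠ b i := by
    intro i
    fin_cases i
    exacts [h₁, h₂, h₃]
  refine (hG {v | ∃ i, v ∈ (P i).support}).2.1 ⟨a, b, P, fun i => ⟨hP i, ?_⟩, ?_, hab, ?_, rfl⟩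
  · exact length_one_le _ (hne i)
  · intro i j hij u hu hu'
    exact (hS i j hij u (hPS i u hu) u (hPS j u hu')).1 rfl
  · intro i j hij u hu v hv huv
    exact (hS i j hij u (hPS i u hu) v (hPS j v hv)).2 huv

lemma square_false (hG : InClassC G) {a b c d : V} (hab : G.Adj a b) (hbc : G.Adj b c)
    (hcd : G.Adj c d) (hda : G.Adj d a) (hac : a ≠ c) (hac' : ¬ G.Adj a c) (hbd : b ≠ d)
    (hbd' : ¬ G.Adj b d) : False := by
  have h : IsHole G ({x | x ∈ (Walk.cons hab .nil).support} ∪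
      {x | x ∈ (Walk.cons hcd .nil).support}) := by
    refine isHole_of_paths ?_ ?_ hbc hda ?_ (by simp)
    · exact (isIndPath_cons _ _).2 ⟨isIndPath_nil, by simpa using hab.ne, by simp⟩
    · exact (isIndPath_cons _ _).2 ⟨isIndPath_nil, by simpa using hcd.ne, by simp⟩
    · intro x hx y hy
      simp only [Walk.support_cons, Walk.support_nil, List.mem_cons, List.not_mem_nil,
        or_false] at hx hy
      rcases hx with rfl | rfl <;> rcases hy with rfl | rfl
      · exact ⟨hac, fun h => absurd h hac'⟩
      · exact ⟨hda.ne', fun _ => Or.inr ⟨rfl, rfl⟩⟩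
      · exact ⟨hbc.ne, fun _ => Or.inl ⟨rfl, rfl⟩⟩
      · exact ⟨hbd, fun h => absurd h hbd'⟩
  refine (hG _).1 ⟨h, ?_⟩
  classical
  have : ({x | x ∈ (Walk.cons hab .nil).support} ∪ {x | x ∈ (Walk.cons hcd .nil).support} : Set V)
      = ↑(insert a (insert b (insert c {d})) : Finset V) := by
    ext x
    simp [or_assoc]
  rw [this, Set.ncard_coe_finset, Finset.card_insert_of_notMem, Finset.card_insert_of_notMem,
    Finset.card_insert_of_notMem, Finset.card_singleton]
  · simpa using hcd.ne
  · simpa using ⟨hbc.ne, hbd⟩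
  · simpa using ⟨hab.ne, hac, hda.ne'⟩

/-! ### Linking arguments -/

lemma exists_first {P : ℤ → Prop} {i j : ℤ} (h : ∃ m, i ≤ m ∧ m ≤ j ∧ P m) :
    ∃ a, i ≤ a ∧ a ≤ j ∧ P a ∧ ∀ m, i ≤ m → m ≤ j → P m → a ≤ m := by
  obtain ⟨a, ha, hmin⟩ := Int.exists_least_of_bdd (P := fun m => i ≤ m ∧ m ≤ j ∧ P m)
    ⟨i, fun z hz => hz.1⟩ h
  exact ⟨a, ha.1, ha.2.1, ha.2.2, fun m h1 h2 h3 => hmin m ⟨h1, h2, h3⟩⟩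

lemma exists_last {P : ℤ → Prop} {i j : ℤ} (h : ∃ m, i ≤ m ∧ m ≤ j ∧ P m) :
    ∃ a, i ≤ a ∧ a ≤ j ∧ P a ∧ ∀ m, i ≤ m → m ≤ j → P m → m ≤ a := by
  obtain ⟨a, ha, hmax⟩ := Int.exists_greatest_of_bdd (P := fun m => i ≤ m ∧ m ≤ j ∧ P m)
    ⟨j, fun z hz => hz.2.1⟩ h
  exact ⟨a, ha.1, ha.2.1, ha.2.2, fun m h1 h2 h3 => hmax m ⟨h1, h2, h3⟩⟩

lemma LinearOn.anti {f : ℤ → V} {i j a b c d : ℤ} (h : LinearOn G f i j) (ha : i ≤ a)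
    (hbc : b + 2 ≤ c) (hd : d ≤ j) : Anti G (f '' Set.Icc a b) (f '' Set.Icc c d) := by
  rintro _ ⟨s, ⟨hs, hs'⟩, rfl⟩ _ ⟨t, ⟨ht, ht'⟩, rfl⟩
  obtain ⟨h1, h2⟩ := h s t (by omega) (by omega) (by omega)
  exact ⟨h1, fun e => by have := h2.1 e; omega⟩

/-- In the hole formed by `w` and the path `f i … f j`, a vertex `u` nonadjacent to `w` and
linked to `w` off the path attaches, if at all, only to one of the neighbors of `w`. -/
lemma link_false (hG : InClassC G) {f : ℤ → V} {i j : ℤ} (hf : LinearOn G f i j) (hij : i + 2 ≤ j)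
    {w u : V} {X : Set V}
    (hw : ∀ m, i ≤ m → m ≤ j → f m ≠ w ∧ (G.Adj w (f m) ↔ m = i ∨ m = j))
    (hu : ∀ m, i ≤ m → m ≤ j → f m ≠ u) (huw : u ≠ w) (huw' : ¬ G.Adj u w)
    (hX : ∀ x ∈ X, ∀ m, i ≤ m → m ≤ j → x ≠ f m ∧ ¬ G.Adj x (f m))
    (hR : Reach G (insert u (insert w X)) u w)
    (hA : ∃ m, i ≤ m ∧ m ≤ j ∧ G.Adj u (f m))
    (hi : ∃ m, i ≤ m ∧ m ≤ j ∧ ¬ (G.Adj u (f m) ↔ m = i))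
    (hj : ∃ m, i ≤ m ∧ m ≤ j ∧ ¬ (G.Adj u (f m) ↔ m = j)) : False := by
  obtain ⟨a, ha, ha', hua, hamin⟩ := exists_first hA
  obtain ⟨b, hb, hb', hub, hbmax⟩ := exists_last hA
  have hab : a ≤ b := hamin b hb hb' hub
  have hwi : G.Adj w (f i) := ((hw i le_rfl (by omega)).2.2 (Or.inl rfl))
  have hwj : G.Adj w (f j) := ((hw j (by omega) le_rfl).2.2 (Or.inr rfl))
  have hXf : ∀ c d, i ≤ c → d ≤ j → Anti G (f '' Set.Icc c d) X := by
    rintro c d hc hd _ ⟨s, ⟨hs, hs'⟩, rfl⟩ x hx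
    obtain ⟨h1, h2⟩ := hX x hx s (by omega) (by omega)
    exact ⟨h1.symm, fun e => h2 e.symm⟩
  have hwX : w ∉ X := fun h => (hX w h i le_rfl (by omega)).2 hwi
  have reachL : ∀ {Y : Set V} c, i ≤ c → c ≤ j → w ∈ Y → (∀ m, i ≤ m → m ≤ c → f m ∈ Y) →
      Reach G Y (f c) w := by
    intro Y c hc hc' hwY hY
    refine (hf.mono le_rfl hc').reach (s := c) (t := i) hY hc le_rfl le_rfl hc |>.trans ?_
    exact .of_adj hwi.symm (hY i le_rfl hc) hwY
  have reachR : ∀ {Y : Set V} c, i ≤ c → c ≤ j → w ∈ Y → (∀ m, c ≤ m → m ≤ j → f m ∈ Y) →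
      Reach G Y (f c) w := by
    intro Y c hc hc' hwY hY
    refine (hf.mono hc le_rfl).reach (s := c) (t := j) hY le_rfl hc' hc' le_rfl |>.trans ?_
    exact .of_adj hwj.symm (hY j hc' le_rfl) hwY
  rcases lt_trichotomy b (a + 1) with h | h | h
  -- One attachment: `hi` and `hj` put it strictly inside the path, hence nonadjacent to `w`. The
  -- theta joins `f a` to `w` along both halves of the path and through `u`.
  · obtain rfl : a = b := by omega
    have honly : ∀ m, i ≤ m → m ≤ j → G.Adj u (f m) → m = a := fun m h1 h2 h3 =>
      le_antisymm (hbmax m h1 h2 h3) (hamin m h1 h2 h3)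
    have hai : a ≠ i := by
      rintro rfl
      obtain ⟨m, h1, h2, h3⟩ := hi
      exact h3 ⟨honly m h1 h2, by rintro rfl; exact hua⟩
    have haj : a ≠ j := by
      rintro rfl
      obtain ⟨m, h1, h2, h3⟩ := hj
      exact h3 ⟨honly m h1 h2, by rintro rfl; exact hua⟩
    have hu' : ∀ c d, i ≤ c → d ≤ j → (a < c ∨ d < a) →
        Anti G (f '' Set.Icc c d) (insert u X) := by
      rintro c d hc hd hcd x hx y (rfl | hy)
      · obtain ⟨s, ⟨hs, hs'⟩, rfl⟩ := hx
        refine ⟨hu s (by omega) (by omega), fun e => ?_⟩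
        have := honly s (by omega) (by omega) e.symm
        omega
      · exact hXf c d hc hd x hx y hy
    refine theta_false hG (hw a ha ha').1 ?_ (hf.anti le_rfl (by omega) le_rfl)
      (hu' i (a - 1) le_rfl (by omega) (Or.inr (by omega)))
      (hu' (a + 1) j (by omega) le_rfl (Or.inl (by omega))) ?_ ?_ ?_
    · intro e
      have := (hw a ha ha').2.1 e.symm
      omega
    · refine reachL a ha ha' (by simp) fun m h1 h2 => ?_
      rcases eq_or_lt_of_le h2 with rfl | h2
      · simp
      · exact Or.inr (Or.inr ⟨m, ⟨h1, by omega⟩, rfl⟩)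
    · refine reachR a ha ha' (by simp) fun m h1 h2 => ?_
      rcases eq_or_lt_of_le h1 with rfl | h1
      · simp
      · exact Or.inr (Or.inr ⟨m, ⟨by omega, h2⟩, rfl⟩)
    · refine Reach.trans (.of_adj hua.symm (by simp) (by simp)) (hR.mono ?_)
      rintro x (rfl | rfl | hx)
      · simp
      · simp
      · simp [hx]
  · subst h
    have honly : ∀ m, i ≤ m → m ≤ j → G.Adj u (f m) → m = a ∨ m = a + 1 := fun m h1 h2 h3 => by
      have := hbmax m h1 h2 h3
      have := hamin m h1 h2 h3
      omega
    have hu' : ∀ c d k, i ≤ c → d ≤ j → (∀ m, c ≤ m → m ≤ d → m = a ∨ m = a + 1 → m = k) →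
        ∀ x ∈ insert u X, ∀ y ∈ f '' Set.Icc c d, x ≠ y ∧ (G.Adj x y → x = u ∧ y = f k) := by
      rintro c d k hc hd hk x (rfl | hx) y ⟨s, ⟨hs, hs'⟩, rfl⟩
      · refine ⟨(hu s (by omega) (by omega)).symm, fun e => ⟨rfl, ?_⟩⟩
        rw [hk s hs hs' (honly s (by omega) (by omega) e)]
      · obtain ⟨h1, h2⟩ := hX x hx s (by omega) (by omega)
        exact ⟨h1, fun e => absurd e h2⟩
    have hwf : ∀ c d, i ≤ c → d ≤ j → w ∉ f '' Set.Icc c d := by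
      rintro c d hc hd ⟨s, ⟨hs, hs'⟩, h⟩
      exact (hw s (by omega) (by omega)).1 h
    have hiff : G.Adj (f a) (f (a + 1)) := (hf a (a + 1) ha (by omega) hb').2.2 rfl
    -- Two consecutive attachments: the triangle is `u`, `f a`, `f (a + 1)` and the apex is `w`.
    refine pyramid_false hG (a := w) (b₁ := u) (b₂ := f a) (b₃ := f (a + 1)) (X := insert u X)
      (Y := f '' Set.Icc i a) (Z := f '' Set.Icc (a + 1) j) (by simp)
      ⟨a, ⟨ha, le_rfl⟩, rfl⟩ ⟨a + 1, ⟨le_rfl, hb'⟩, rfl⟩ ?_ (hwf _ _ le_rfl ha')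
      (hwf _ _ hb le_rfl) hua hub hiff (hu' i a a le_rfl ha' (by intros; omega))
      (hu' (a + 1) j (a + 1) hb le_rfl (by intros; omega)) ?_ ?_ ?_ ?_ ?_
    · rintro (h | h)
      exacts [huw h.symm, hwX h]
    · rintro _ ⟨s, ⟨hs, hs'⟩, rfl⟩ _ ⟨t, ⟨ht, ht'⟩, rfl⟩
      obtain ⟨h1, h2⟩ := hf s t hs (by omega) ht'
      refine ⟨h1, fun e => ?_⟩
      have := h2.1 e
      obtain rfl : s = a := by omega
      obtain rfl : t = s + 1 := by omega
      exact ⟨rfl, rfl⟩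
    · refine hR.symm.mono ?_
      rintro x (rfl | rfl | hx)
      · simp
      · simp
      · simp [hx]
    · exact (reachL a ha ha' (by simp) fun m h1 h2 => Or.inr ⟨m, ⟨h1, h2⟩, rfl⟩).symm
    · exact (reachR (a + 1) hb hb' (by simp) fun m h1 h2 => Or.inr ⟨m, ⟨h1, h2⟩, rfl⟩).symm
    · have h1 : ¬ G.Adj w u := fun e => huw' e.symm
      rw [(hw a ha ha').2, (hw _ hb hb').2]
      -- As `i + 2 ≤ j`, the apex is adjacent to at most one of `f a`, `f (a + 1)`, and it is not
      -- adjacent to `u`; so two of the paths are long.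
      by_cases h2 : a = i
      · exact Or.inr (Or.inl ⟨h1, by omega⟩)
      · exact Or.inl ⟨h1, by omega⟩
  -- The extreme attachments are nonadjacent: the theta joins `u` to `w` through `f a … f i`, `f b …
  -- f j` and `X`.
  · refine theta_false hG huw huw' (hf.anti (a := i) (b := a) (c := b) (d := j) le_rfl (by omega)
      le_rfl) (hXf i a le_rfl ha') (hXf b j hb le_rfl) ?_ ?_ hR
    · refine Reach.trans (.of_adj hua (by simp) ?_) (reachL a ha ha' (by simp) fun m h1 h2 => ?_)
      · exact Or.inr (Or.inr ⟨a, ⟨ha, le_rfl⟩, rfl⟩)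
      · exact Or.inr (Or.inr ⟨m, ⟨h1, h2⟩, rfl⟩)
    · refine Reach.trans (.of_adj hub (by simp) ?_) (reachR b hb hb' (by simp) fun m h1 h2 => ?_)
      · exact Or.inr (Or.inr ⟨b, ⟨le_rfl, hb'⟩, rfl⟩)
      · exact Or.inr (Or.inr ⟨m, ⟨h1, h2⟩, rfl⟩)

/-- Two nonadjacent common neighbors of `w`, the ends of a path with no other neighbor of `w`, are
not linked by a set anticomplete to `w` and to the interior of the path. -/
lemma common_nbrs_false (hG : InClassC G) {f : ℤ → V} {i j : ℤ} (hf : LinearOn G f i j)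
    (hij : i + 2 ≤ j) {w : V} {X : Set V} (hwi : G.Adj w (f i)) (hwj : G.Adj w (f j))
    (hw : ∀ m, i < m → m < j → w ≠ f m ∧ ¬ G.Adj w (f m))
    (hwX : ∀ x ∈ X, w ≠ x ∧ ¬ G.Adj w x)
    (hX : ∀ m, i < m → m < j → ∀ x ∈ X, f m ≠ x ∧ ¬ G.Adj (f m) x)
    (hR : Reach G (insert (f i) (insert (f j) X)) (f i) (f j)) : False := by
  obtain ⟨h1, h2⟩ := hf i j le_rfl (by omega) le_rfl
  -- The three routes from `f i` to `f j` go through `w`, the interior of the path, and `X`.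
  refine theta_false hG (X := {w}) (Y := f '' Set.Icc (i + 1) (j - 1)) (Z := X) h1
    (fun e => by have := h2.1 e; omega) ?_ ?_ ?_ ?_ ?_ hR
  · rintro _ rfl _ ⟨s, ⟨hs, hs'⟩, rfl⟩
    exact hw s (by omega) (by omega)
  · rintro _ rfl x hx
    exact hwX x hx
  · rintro _ ⟨s, ⟨hs, hs'⟩, rfl⟩ x hx
    exact hX s (by omega) (by omega) x hx
  · exact Reach.trans (.of_adj hwi.symm (by simp) (by simp)) (.of_adj hwj (by simp) (by simp))
  · refine hf.reach (fun m h1 h2 => ?_) le_rfl (by omega) (by omega) le_rfl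
    rcases eq_or_lt_of_le h1 with rfl | h1
    · simp
    rcases eq_or_lt_of_le h2 with rfl | h2
    · simp
    exact Or.inr (Or.inr ⟨m, ⟨by omega, by omega⟩, rfl⟩)

/-! ### Neighbors of a major vertex in the hole -/

lemma Ring.adj_cases {f : ℤ → V} {N : ℤ} (h : Ring G f N) {s : ℤ} {x : V} (hx : x ∈ Set.range f)
    (hsx : G.Adj (f s) x) : x = f (s + 1) ∨ x = f (s - 1) := by
  obtain ⟨t, rfl⟩ := hx
  obtain ⟨t', -, h1, h2, h3, -⟩ := h.exists_rep s t
  rw [← h3] at hsx ⊢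
  rcases eq_or_lt_of_le h1 with rfl | h1
  · exact absurd hsx (G.loopless.irrefl _)
  rcases (h.adj s t' h1 h2).2.1 hsx with rfl | h4
  · exact Or.inl rfl
  · right
    rw [← h.per (s - 1)]
    congr 1; omega

lemma Ring.adj_succ {f : ℤ → V} {N : ℤ} (h : Ring G f N) (s : ℤ) : G.Adj (f s) (f (s + 1)) :=
  (h.adj s (s + 1) (by omega) (by have := h.four_le; omega)).2.2 (Or.inl rfl)

/-- A vertex with exactly two neighbors in a hole has adjacent neighbors there. -/
lemma adj_of_two_nbrs (hG : InClassC G) {f : ℤ → V} {N : ℤ} (h : Ring G f N) {w x y : V}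
    (hw : ∀ m, f m ≠ w) (h2 : (G.neighborSet w ∩ Set.range f).ncard = 2)
    (hx : x ∈ G.neighborSet w ∩ Set.range f) (hy : y ∈ G.neighborSet w ∩ Set.range f)
    (hxy : x ≠ y) : G.Adj x y := by
  by_contra hadj
  have honly : ∀ z ∈ G.neighborSet w ∩ Set.range f, z = x ∨ z = y := by
    obtain ⟨p, q, -, he⟩ := Set.ncard_eq_two.1 h2
    rw [he] at hx hy ⊢
    simp only [Set.mem_insert_iff, Set.mem_singleton_iff] at hx hy ⊢
    intro z hz
    rcases hx with rfl | rfl <;> rcases hy with rfl | rfl <;> tauto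
  obtain ⟨hwx, i, rfl⟩ := hx
  obtain ⟨hwy, j, rfl⟩ := hy
  obtain ⟨j', -, h3, h4, h5, -⟩ := h.exists_rep i j
  rw [← h5] at hwy hxy hadj honly
  rw [SimpleGraph.mem_neighborSet] at hwx hwy
  have hij : i < j' := lt_of_le_of_ne h3 (by rintro rfl; exact hxy rfl)
  have h6 := (h.adj i j' hij h4).2
  have h7 : i + 2 ≤ j' ∧ j' + 2 ≤ i + N := by
    constructor
    · by_contra hc; exact hadj (h6.2 (Or.inl (by omega)))
    · by_contra hc; exact hadj (h6.2 (Or.inr (by omega)))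
  have hnot : ∀ m, i < m → m < i + N → m ≠ j' → ¬ G.Adj w (f m) := by
    intro m hm hm' hne hwm
    rcases honly (f m) ⟨hwm, m, rfl⟩ with e | e
    · exact (h.adj i m hm hm').1 e.symm
    · exact hne (h.inj hm.le hm' hij.le h4 e)
  -- The second arc of the hole between the two neighbors plays the role of the linking set.
  refine common_nbrs_false hG (h.linearOn (i := i) (j := j') h7.2) h7.1 hwx hwy
    (X := f '' Set.Icc (j' + 1) (i + N - 1))
    (fun m hm hm' => ⟨(hw m).symm, hnot m hm (by omega) (by omega)⟩) ?_ ?_ ?_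
  · rintro _ ⟨s, ⟨hs, hs'⟩, rfl⟩
    exact ⟨(hw s).symm, hnot s (by omega) (by omega) (by omega)⟩
  · rintro m hm hm' _ ⟨s, ⟨hs, hs'⟩, rfl⟩
    obtain ⟨h8, h9⟩ := h.adj m s (by omega) (by omega)
    exact ⟨h8, fun e => by have := h9.1 e; omega⟩
  · rw [← h.per i]
    refine (h.linearOn (i := j') (j := i + N) (by omega)).reach (fun m h1 h2 => ?_)
      (by omega) le_rfl le_rfl (by omega)
    rcases eq_or_lt_of_le h1 with rfl | h1
    · simp
    rcases eq_or_lt_of_le h2 with rfl | h2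
    · simp
    exact Or.inr (Or.inr ⟨m, ⟨by omega, by omega⟩, rfl⟩)

lemma Ring.ncard_nbrs {f : ℤ → V} {N : ℤ} (h : Ring G f N) (w : V) (c : ℤ) :
    (G.neighborSet w ∩ Set.range f).ncard =
      {m : ℤ | c ≤ m ∧ m < c + N ∧ G.Adj w (f m)}.ncard := by
  have : G.neighborSet w ∩ Set.range f = f '' {m : ℤ | c ≤ m ∧ m < c + N ∧ G.Adj w (f m)} := by
    ext x
    constructor
    · rintro ⟨hx, m, rfl⟩
      obtain ⟨m', -, h1, h2, h3, -⟩ := h.exists_rep c m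
      exact ⟨m', ⟨h1, h2, by rw [h3]; exact hx⟩, h3⟩
    · rintro ⟨m, ⟨-, -, hm⟩, rfl⟩
      exact ⟨hm, m, rfl⟩
  rw [this]
  refine Set.InjOn.ncard_image fun s hs t ht hst => ?_
  exact h.inj hs.1 hs.2.1 ht.1 ht.2.1 hst

/-- The data of a hole parametrized by `f` and a vertex `w` that is major with respect to it. -/
structure Wheel (G : SimpleGraph V) (f : ℤ → V) (N : ℤ) (w : V) : Prop where
  cls : InClassC G
  ring : Ring G f N
  notMem : ∀ m, f m ≠ w
  three_le : 3 ≤ (G.neighborSet w ∩ Set.range f).ncard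
  odd : Odd (G.neighborSet w ∩ Set.range f).ncard
  spread : (G.neighborSet w ∩ Set.range f).ncard = 3 →
    ∀ m, G.Adj w (f m) → ¬ G.Adj w (f (m + 1))

lemma Ring.isHole {f : ℤ → V} {N : ℤ} (h : Ring G f N) : IsHole G (Set.range f) := by
  have h4 := h.four_le
  obtain ⟨R, hR, hl, hs⟩ := (h.linearOn (i := 1) (j := N - 1) (by omega)).exists_walk (by omega)
  have h0 := h.adj_succ 0
  have h1 := h.adj_succ (N - 1)
  rw [show N - 1 + 1 = 0 + N by omega, h.per] at h1
  convert isHole_of_paths (isIndPath_nil (u := f 0)) hR h0 h1 ?_ ?_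
  · ext x
    simp only [Walk.support_nil, List.mem_singleton, Set.mem_union, Set.mem_ofPred_eq, hs]
    constructor
    · rintro ⟨m, rfl⟩
      obtain ⟨m', -, h1, h2, h3, -⟩ := h.exists_rep 0 m
      rw [← h3]
      rcases eq_or_lt_of_le h1 with rfl | h1
      · exact Or.inl rfl
      · exact Or.inr ⟨m', by omega, by omega, rfl⟩
    · rintro (rfl | ⟨m, -, -, rfl⟩) <;> exact ⟨_, rfl⟩
  · intro x hx y hy
    simp only [Walk.support_nil, List.mem_singleton] at hx
    subst hx
    obtain ⟨m, h2, h3, rfl⟩ := (hs y).1 hy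
    obtain ⟨h5, h6⟩ := h.adj 0 m (by omega) (by omega)
    refine ⟨h5, fun e => ?_⟩
    rcases h6.1 e with rfl | h7
    · exact Or.inl ⟨rfl, rfl⟩
    · obtain rfl : m = N - 1 := by omega
      exact Or.inr ⟨rfl, rfl⟩
  · simp; omega

lemma not_even_nbrs (hG : InClassC G) {H : Set V} (hH : IsHole G H) {w : V} (hw : w ∉ H)
    (h3 : 3 ≤ (G.neighborSet w ∩ H).ncard) : Odd (G.neighborSet w ∩ H).ncard := by
  by_contra h
  rw [Nat.not_odd_iff_even] at h
  exact (hG (insert w H)).2.2.2.2 ⟨H, w, hH, hw, h3, h, rfl⟩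

lemma Ring.not_isMajor {f : ℤ → V} {N : ℤ} (h : Ring G f N) {w : V} (c : ℤ)
    (hc : ∀ x ∈ G.neighborSet w ∩ Set.range f, x = f c ∨ x = f (c + 1) ∨ x = f (c + 2)) :
    ¬ IsMajor G (Set.range f) w := by
  have h4 := h.four_le
  rintro ⟨-, hM⟩
  obtain ⟨P, hP, hl, hs⟩ := (h.linearOn (i := c) (j := c + 2) (by omega)).exists_walk (by omega)
  refine hM ⟨_, _, P, ⟨hP, fun v hv => ?_⟩, by omega, fun v hv => ?_⟩
  · obtain ⟨m, -, -, rfl⟩ := (hs v).1 hv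
    exact ⟨m, rfl⟩
  · rw [hs]
    rcases hc v hv with rfl | rfl | rfl
    exacts [⟨c, by omega, by omega, rfl⟩, ⟨c + 1, by omega, by omega, rfl⟩,
      ⟨c + 2, by omega, by omega, rfl⟩]

/-- At most one neighbor, or two adjacent ones, fit in a 3-vertex path; two nonadjacent ones give a
theta. From three on, an even number is an even wheel. With exactly three, two of them adjacent, the
third is not next to either, by majority of `w`, and there is a pyramid. -/
lemma wheel_of_major [Finite V] (hG : InClassC G) {f : ℤ → V} {N : ℤ} (h : Ring G f N) {w : V}
    (hw : IsMajor G (Set.range f) w) : Wheel G f N w := by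
  have h4 := h.four_le
  have hwf : ∀ m, f m ≠ w := fun m e => hw.1 ⟨m, e⟩
  have h3 : 3 ≤ (G.neighborSet w ∩ Set.range f).ncard := by
    by_contra hlt
    rcases Nat.lt_or_ge (G.neighborSet w ∩ Set.range f).ncard 2 with h1 | h2
    · by_cases hne : (G.neighborSet w ∩ Set.range f).Nonempty
      · obtain ⟨x, hx⟩ := hne
        obtain ⟨c, hc⟩ := hx.2
        refine h.not_isMajor c (fun y hy => Or.inl ?_) hw
        rw [hc]
        exact (Set.ncard_le_one_iff (Set.toFinite _)).1 (by omega) hy hx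
      · rw [Set.not_nonempty_iff_eq_empty] at hne
        exact h.not_isMajor 0 (by simp [hne]) hw
    · have h2 : (G.neighborSet w ∩ Set.range f).ncard = 2 := by omega
      obtain ⟨x, y, hxy, he⟩ := Set.ncard_eq_two.1 h2
      have hx : x ∈ G.neighborSet w ∩ Set.range f := by simp [he]
      have hy : y ∈ G.neighborSet w ∩ Set.range f := by simp [he]
      have hadj := adj_of_two_nbrs hG h hwf h2 hx hy hxy
      rw [he] at hx hy
      obtain ⟨c, rfl⟩ : x ∈ Set.range f := by
        have : x ∈ G.neighborSet w ∩ Set.range f := by simp [he]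
        exact this.2
      have hyr : y ∈ Set.range f := by
        have : y ∈ G.neighborSet w ∩ Set.range f := by simp [he]
        exact this.2
      rcases h.adj_cases hyr hadj with rfl | rfl
      · refine h.not_isMajor c ?_ hw
        rw [he]
        rintro z (rfl | rfl) <;> simp
      · refine h.not_isMajor (c - 1) ?_ hw
        rw [he]
        rintro z (rfl | rfl) <;> simp
  refine ⟨hG, h, hwf, h3, not_even_nbrs hG h.isHole hw.1 h3, ?_⟩
  intro hK m hm hm'
  have hx : f m ∈ G.neighborSet w ∩ Set.range f := ⟨hm, m, rfl⟩
  have hy : f (m + 1) ∈ G.neighborSet w ∩ Set.range f := ⟨hm', m + 1, rfl⟩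
  have hxy : f m ≠ f (m + 1) := (h.adj_succ m).ne
  obtain ⟨z, hz, hzn⟩ : ∃ z ∈ G.neighborSet w ∩ Set.range f, z ∉ ({f m, f (m + 1)} : Set V) := by
    refine Set.exists_mem_notMem_of_ncard_lt_ncard ?_ (Set.toFinite _)
    rw [hK, Set.ncard_pair hxy]
    omega
  have honly : ∀ y ∈ G.neighborSet w ∩ Set.range f, y = z ∨ y = f m ∨ y = f (m + 1) := by
    have : ({z, f m, f (m + 1)} : Set V) = G.neighborSet w ∩ Set.range f := by
      refine Set.eq_of_subset_of_ncard_le ?_ ?_ (Set.toFinite _)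
      · rintro y (rfl | rfl | rfl) <;> assumption
      · rw [Set.ncard_insert_of_notMem hzn, Set.ncard_pair hxy, hK]
    intro y hy
    rw [← this] at hy
    exact hy
  obtain ⟨hwz, r', rfl⟩ := hz
  obtain ⟨r, -, h1, h2, h5, -⟩ := h.exists_rep m r'
  rw [← h5] at hwz hzn honly
  rw [SimpleGraph.mem_neighborSet] at hwz
  have hr1 : r ≠ m := by rintro rfl; simp at hzn
  have hr2 : r ≠ m + 1 := by rintro rfl; simp at hzn
  have hr3 : r ≠ m + 2 := by
    rintro rfl
    refine h.not_isMajor m (fun x hx => ?_) hw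
    rcases honly x hx with h | h | h <;> simp [h]
  have hr4 : r ≠ m + N - 1 := by
    rintro rfl
    refine h.not_isMajor (m - 1) (fun x hx => ?_) hw
    have e : f (m + N - 1) = f (m - 1) := by rw [← h.per (m - 1)]; congr 1; omega
    rw [show m - 1 + 1 = m by omega, show m - 1 + 2 = m + 1 by omega, ← e]
    exact honly x hx
  have hnot : ∀ s, m < s → s < m + N → s ≠ r → s ≠ m + 1 → ¬ G.Adj w (f s) := by
    intro s hs hs' hsr hs1 hws
    rcases honly (f s) ⟨hws, s, rfl⟩ with e | e | e
    · exact hsr (h.inj hs.le hs' h1 h2 e)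
    · exact hs.ne (h.inj le_rfl (by omega) hs.le hs' e.symm)
    · exact hs1 (h.inj hs.le hs' (by omega) (by omega) e)
  have hNm := h.per m
  -- The apex is the isolated neighbor `f r`, the triangle is `w`, `f (m + 1)`, `f m`. Writing `f m`
  -- as `f (m + N)` makes both arcs from `r` intervals of the same window.
  refine pyramid_false hG (a := f r) (b₁ := w) (b₂ := f (m + 1)) (b₃ := f (m + N))
    (X := {w}) (Y := f '' Set.Icc (m + 1) (r - 1)) (Z := f '' Set.Icc (r + 1) (m + N)) rfl
    ⟨m + 1, ⟨le_rfl, by omega⟩, rfl⟩ ⟨m + N, ⟨by omega, le_rfl⟩, rfl⟩ (hwf r) ?_ ?_ hm'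
    (by rw [hNm]; exact hm) (by rw [hNm]; exact (h.adj_succ m).symm) ?_ ?_ ?_ ?_ ?_ ?_ ?_
  · rintro ⟨s, ⟨hs, hs'⟩, e⟩
    exact (h.adj s r (by omega) (by omega)).1 e
  · rintro ⟨s, ⟨hs, hs'⟩, e⟩
    exact (h.adj r s (by omega) (by omega)).1 e.symm
  · rintro _ rfl _ ⟨s, ⟨hs, hs'⟩, rfl⟩
    refine ⟨(hwf s).symm, fun e => ⟨rfl, ?_⟩⟩
    by_contra hne
    exact hnot s (by omega) (by omega) (by omega) (fun e => hne (by rw [e])) e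
  · rintro _ rfl _ ⟨s, ⟨hs, hs'⟩, rfl⟩
    refine ⟨(hwf s).symm, fun e => ⟨rfl, ?_⟩⟩
    by_contra hne
    exact hnot s (by omega) (lt_of_le_of_ne hs' fun e => hne (by rw [e])) (by omega) (by omega) e
  · rintro _ ⟨s, ⟨hs, hs'⟩, rfl⟩ _ ⟨t, ⟨ht, ht'⟩, rfl⟩
    obtain ⟨h6, h7⟩ := h.adj s t (by omega) (by omega)
    refine ⟨h6, fun e => ?_⟩
    have := h7.1 e
    rw [show s = m + 1 by omega, show t = m + N by omega]
    exact ⟨rfl, rfl⟩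
  · exact .of_adj hwz.symm (by simp) (by simp)
  · refine (h.linearOn (i := m + 1) (j := r) (by omega)).reach (fun s hs hs' => ?_)
      (by omega) (by omega) (by omega) (by omega)
    rcases eq_or_lt_of_le hs' with rfl | hs'
    · simp
    · exact Or.inr ⟨s, ⟨hs, by omega⟩, rfl⟩
  · refine (h.linearOn (i := r) (j := m + N) (by omega)).reach (fun s hs hs' => ?_)
      (by omega) (by omega) (by omega) (by omega)
    rcases eq_or_lt_of_le hs with rfl | hs
    · simp
    · exact Or.inr ⟨s, ⟨by omega, hs'⟩, rfl⟩
  · refine Or.inr (Or.inr ⟨fun e => ?_, fun e => ?_⟩)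
    · have := (h.adj (m + 1) r (by omega) (by omega)).2.1 e.symm
      omega
    · have := (h.adj r (m + N) (by omega) (by omega)).2.1 e
      omega

/-! ### Sectors -/

/-- The consecutive neighbors `f i` and `f j` of `w` bound a sector. -/
def Sec (G : SimpleGraph V) (f : ℤ → V) (w : V) (i j : ℤ) : Prop :=
  i < j ∧ G.Adj w (f i) ∧ G.Adj w (f j) ∧ ∀ m, i < m → m < j → ¬ G.Adj w (f m)

lemma Sec.right_eq {f : ℤ → V} {w : V} {i j i' j' : ℤ} (hs : Sec G f w i j) (hs' : Sec G f w i' j')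
    (hi : i = i') : j = j' := by
  subst hi
  rcases lt_trichotomy j j' with h1 | h1 | h1
  · exact absurd hs.2.2.1 (hs'.2.2.2 j hs.1 h1)
  · exact h1
  · exact absurd hs'.2.2.1 (hs.2.2.2 j' hs'.1 h1)

namespace Wheel

variable {f : ℤ → V} {N : ℤ} {w : V}

lemma reflect (h : Wheel G f N w) : Wheel G (fun i => f (-i)) N w := by
  have hr : Set.range (fun i => f (-i)) = Set.range f :=
    (Equiv.neg ℤ).surjective.range_comp f
  refine ⟨h.cls, h.ring.reflect, fun m => h.notMem _, ?_, ?_, ?_⟩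
  · rw [hr]; exact h.three_le
  · rw [hr]; exact h.odd
  · rw [hr]
    intro hK m hm hm'
    refine h.spread hK (-(m + 1)) hm' ?_
    rw [show -(m + 1) + 1 = -m by ring]
    exact hm

lemma exists_notMem (h : Wheel G f N w) (c : ℤ) (S : Finset ℤ)
    (hS : S.card < (G.neighborSet w ∩ Set.range f).ncard) :
    ∃ r, c ≤ r ∧ r < c + N ∧ G.Adj w (f r) ∧ r ∉ S := by
  rw [h.ring.ncard_nbrs w c, ← Set.ncard_coe_finset] at hS
  obtain ⟨r, hr, hrS⟩ := Set.exists_mem_notMem_of_ncard_lt_ncard hS (Finset.finite_toSet S)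
  exact ⟨r, hr.1, hr.2.1, hr.2.2, by simpa using hrS⟩

lemma exists_third (h : Wheel G f N w) (c a b : ℤ) :
    ∃ r, c ≤ r ∧ r < c + N ∧ G.Adj w (f r) ∧ r ≠ a ∧ r ≠ b := by
  obtain ⟨r, h1, h2, h3, h4⟩ := h.exists_notMem c {a, b}
    (lt_of_le_of_lt Finset.card_le_two (by have := h.three_le; omega))
  simp only [Finset.mem_insert, Finset.mem_singleton, not_or] at h4
  exact ⟨r, h1, h2, h3, h4⟩

lemma exists_nbr (h : Wheel G f N w) (c : ℤ) : ∃ r, c ≤ r ∧ r < c + N ∧ G.Adj w (f r) := by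
  obtain ⟨r, h1, h2, h3, -⟩ := h.exists_third c 0 0
  exact ⟨r, h1, h2, h3⟩

lemma exists_sec (h : Wheel G f N w) (m : ℤ) : ∃ i j, Sec G f w i j ∧ i ≤ m ∧ m < j := by
  obtain ⟨r, h1, h2, h3⟩ := h.exists_nbr (m - N + 1)
  obtain ⟨s, h4, h5, h6⟩ := h.exists_nbr (m + 1)
  obtain ⟨i, hi0, hi, hwi, hi'⟩ := exists_last (P := fun m => G.Adj w (f m)) (i := m - N + 1) (j := m)
    ⟨r, h1, by omega, h3⟩
  obtain ⟨j, hj, hj0, hwj, hj'⟩ := exists_first (P := fun m => G.Adj w (f m)) (i := m + 1)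
    (j := m + N) ⟨s, h4, by omega, h6⟩
  refine ⟨i, j, ⟨by omega, hwi, hwj, fun t ht ht' hwt => ?_⟩, hi, by omega⟩
  rcases le_or_gt t m with h7 | h7
  · have := hi' t (by omega) h7 hwt; omega
  · have := hj' t (by omega) (by omega) hwt; omega

lemma sec_of_nbr (h : Wheel G f N w) {i : ℤ} (hi : G.Adj w (f i)) : ∃ j, Sec G f w i j := by
  obtain ⟨i', j, hs, h1, h2⟩ := h.exists_sec i
  rcases eq_or_lt_of_le h1 with rfl | h1
  · exact ⟨j, hs⟩
  · exact absurd hi (hs.2.2.2 i h1 h2)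

lemma sec_shift (h : Wheel G f N w) {i j : ℤ} (hs : Sec G f w i j) (k : ℤ) :
    Sec G f w (i + N * k) (j + N * k) := by
  refine ⟨by have := hs.1; omega, by rw [h.ring.per_mul]; exact hs.2.1,
    by rw [h.ring.per_mul]; exact hs.2.2.1, fun m hm hm' hwm => ?_⟩
  refine hs.2.2.2 (m - N * k) (by omega) (by omega) ?_
  rw [← h.ring.per_mul _ k, sub_add_cancel]
  exact hwm

/-- A third neighbor of `w` must lie strictly between `j` and `i + N`. -/
lemma sec_lt (h : Wheel G f N w) {i j : ℤ} (hs : Sec G f w i j) : j + 2 ≤ i + N := by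
  obtain ⟨r, h1, h2, h3, h4, h5⟩ := h.exists_third i i j
  by_contra hcon
  exact hs.2.2.2 r (by omega) (by omega) h3

/-- A long sector misses some neighbor of `w`, together with its neighbors in the hole. -/
lemma exists_far (h : Wheel G f N w) {i j : ℤ} (hs : Sec G f w i j) (hij : i + 2 ≤ j) :
    ∃ r, j + 2 ≤ r ∧ r + 2 ≤ i + N ∧ G.Adj w (f r) := by
  by_contra hcon
  push Not at hcon
  have hcase : ∀ r, i ≤ r → r < i + N → G.Adj w (f r) →
      r = i ∨ r = j ∨ r = j + 1 ∨ r = i + N - 1 := by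
    intro r h1 h2 h3
    by_contra h4
    have h5 := hs.2.2.2 r
    refine hcon r ?_ ?_ h3
    · by_contra h6
      exact h5 (by omega) (by omega) h3
    · omega
  -- Otherwise all neighbors of `w` are among four positions; being odd and at least three, their
  -- number is three. One of them is then next to an end of the sector, against `spread`.
  have hK : (G.neighborSet w ∩ Set.range f).ncard = 3 := by
    have h4 : (G.neighborSet w ∩ Set.range f).ncard ≤ 4 := by
      by_contra h5
      obtain ⟨r, h1, h2, h3, h6⟩ := h.exists_notMem i {i, j, j + 1, i + N - 1}
        (lt_of_le_of_lt Finset.card_le_four (by omega))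
      simp only [Finset.mem_insert, Finset.mem_singleton] at h6
      exact h6 (hcase r h1 h2 h3)
    have := h.three_le
    obtain ⟨k, hk⟩ := h.odd
    omega
  obtain ⟨r, h1, h2, h3, h4, h5⟩ := h.exists_third i i j
  rcases hcase r h1 h2 h3 with rfl | rfl | rfl | rfl
  · exact h4 rfl
  · exact h5 rfl
  · exact h.spread hK j hs.2.2.1 h3
  · refine h.spread hK (i + N - 1) h3 ?_
    rw [sub_add_cancel, h.ring.per]
    exact hs.2.1

/-! ### Parity and far attachments -/

/-- Rerouting the hole along a path `Q` so as to bypass exactly one neighbor of `w` is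
impossible. -/
lemma bypass_false [Finite V] (h : Wheel G f N w) {p q : V} {Q : G.Walk p q} (hQ : IsIndPath Q)
    (hQH : ∀ x ∈ Q.support, ∀ s, x ≠ f s) (hQw : ∀ x ∈ Q.support, x ≠ w ∧ ¬ G.Adj x w)
    {a m b : ℤ} (ham : a < m) (hmb : m < b) (hba : b < a + N) (hwm : G.Adj w (f m))
    (honly : ∀ s, a < s → s < b → G.Adj w (f s) → s = m)
    (hpa : G.Adj p (f a)) (hqb : G.Adj q (f b))
    (hatt : ∀ x ∈ Q.support, ∀ s, b ≤ s → s ≤ a + N → G.Adj x (f s) →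
      (x = p ∧ s = a + N) ∨ (x = q ∧ s = b)) : False := by
  have hspread : (G.neighborSet w ∩ Set.range f).ncard = 3 →
      ∀ x ∈ G.neighborSet w ∩ Set.range f, ∀ y ∈ G.neighborSet w ∩ Set.range f,
      ¬ G.Adj x y := by
    rintro hK x ⟨hwx, s, rfl⟩ y ⟨hwy, hy⟩ hxy
    rcases h.ring.adj_cases hy hxy with rfl | rfl
    · exact h.spread hK s hwx hwy
    · refine h.spread hK (s - 1) hwy ?_
      rw [sub_add_cancel]; exact hwx
  -- If the kept arc were a single edge, the neighbors of `w` would be exactly `f a`, `f m`, `f b`,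
  -- with `f a` and `f b` adjacent, against `spread`.
  have hba' : b + 2 ≤ a + N := by
    by_contra hcon
    have hb : b + 1 = a + N := by omega
    have hcase : ∀ r, a ≤ r → r < a + N → G.Adj w (f r) → r = a ∨ r = m ∨ r = b := by
      intro r h1 h2 h3
      by_contra h4
      have := honly r (by omega) (by omega) h3
      omega
    have hK : (G.neighborSet w ∩ Set.range f).ncard = 3 := by
      have h4 : (G.neighborSet w ∩ Set.range f).ncard ≤ 3 := by
        by_contra h5
        obtain ⟨r, h1, h2, h3, h6⟩ := h.exists_notMem a {a, m, b}
          (lt_of_le_of_lt Finset.card_le_three (by omega))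
        simp only [Finset.mem_insert, Finset.mem_singleton] at h6
        exact h6 (hcase r h1 h2 h3)
      have := h.three_le
      omega
    have hwa : G.Adj w (f a) := by
      obtain ⟨r, h1, h2, h3, h4, h5⟩ := h.exists_third a m b
      rcases hcase r h1 h2 h3 with rfl | rfl | rfl
      exacts [h3, absurd rfl h4, absurd rfl h5]
    have hwb : G.Adj w (f b) := by
      obtain ⟨r, h1, h2, h3, h4, h5⟩ := h.exists_third a a m
      rcases hcase r h1 h2 h3 with rfl | rfl | rfl
      exacts [absurd rfl h4, absurd rfl h5, h3]
    refine h.spread hK b hwb ?_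
    rw [hb, h.ring.per]; exact hwa
  obtain ⟨R, hR, hl, hRs⟩ :=
    (h.ring.linearOn (i := b) (j := a + N) (by omega)).exists_walk hba.le
  have hole := isHole_of_paths hQ hR hqb (by rw [h.ring.per]; exact hpa.symm) ?_ (by omega)
  swap
  · intro x hx y hy
    obtain ⟨s, hs, hs', rfl⟩ := (hRs y).1 hy
    refine ⟨hQH x hx s, fun e => ?_⟩
    rcases hatt x hx s hs hs' e with ⟨rfl, rfl⟩ | ⟨rfl, rfl⟩
    · exact Or.inr ⟨rfl, rfl⟩
    · exact Or.inl ⟨rfl, rfl⟩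
  set H' : Set V := {x | x ∈ Q.support} ∪ {x | x ∈ R.support} with hH'
  have hwH : w ∉ H' := by
    rintro (hw | hw)
    · exact (hQw w hw).1 rfl
    · obtain ⟨s, -, -, e⟩ := (hRs w).1 hw
      exact h.notMem s e
  have hset : G.neighborSet w ∩ H' = (G.neighborSet w ∩ Set.range f) \ {f m} := by
    ext x
    constructor
    · rintro ⟨hwx, hx | hx⟩
      · exact absurd (G.adj_symm hwx) (hQw x hx).2
      · obtain ⟨s, hs, hs', rfl⟩ := (hRs x).1 hx
        refine ⟨⟨hwx, s, rfl⟩, fun e => ?_⟩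
        have := h.ring.inj (c := a + 1) (s := s) (t := m) (by omega) (by omega) (by omega)
          (by omega) e
        omega
    · rintro ⟨⟨hwx, s', rfl⟩, hne⟩
      obtain ⟨s, -, h1, h2, h3, -⟩ := h.ring.exists_rep (a + 1) s'
      rw [← h3] at hwx hne ⊢
      refine ⟨hwx, Or.inr ((hRs _).2 ⟨s, ?_, by omega, rfl⟩)⟩
      by_contra h4
      obtain rfl := honly s (by omega) (by omega) hwx
      exact hne rfl
  have hcard : (G.neighborSet w ∩ H').ncard + 1 = (G.neighborSet w ∩ Set.range f).ncard := by
    rw [hset]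
    exact Set.ncard_sdiff_singleton_add_one ⟨hwm, m, rfl⟩ (Set.toFinite _)
  have h3 := h.three_le
  obtain ⟨k, hk⟩ := h.odd
  -- The new hole contains one neighbor of `w` fewer, an even number. If it is two, they are
  -- adjacent, against `hspread`; otherwise there is an even wheel.
  rcases Nat.lt_or_ge (G.neighborSet w ∩ H').ncard 3 with h4 | h4
  · obtain ⟨x, y, hxy, he⟩ := Set.ncard_eq_two.1
      (show (G.neighborSet w ∩ H').ncard = 2 by omega)
    have hx : x ∈ G.neighborSet w ∩ H' := by simp [he]
    have hy : y ∈ G.neighborSet w ∩ H' := by simp [he]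
    obtain ⟨g, M, hg, hgr⟩ := hole.exists_ring
    rw [hgr] at hx hy hwH
    have hadj := adj_of_two_nbrs h.cls hg (fun m e => hwH ⟨m, e⟩)
      (by rw [← hgr]; omega) hx hy hxy
    rw [← hgr, hset] at hx hy
    exact hspread (by omega) x hx.1 y hy.1 hadj
  · obtain ⟨k', hk'⟩ := not_even_nbrs h.cls hole hwH h4
    omega

/-- A connected set that attaches to a long sector through `u` only, and in a way that is not
confined to an end of the sector, does not attach to the part of the hole far from the sector. -/
lemma far_false (h : Wheel G f N w) {i j : ℤ} (hs : Sec G f w i j) (hij : i + 2 ≤ j)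
    {u : V} {X : Set V} (huH : ∀ m, u ≠ f m) (huw : u ≠ w) (huw' : ¬ G.Adj u w)
    (hX : ∀ x ∈ X, ∀ m, i ≤ m → m ≤ j → x ≠ f m ∧ ¬ G.Adj x (f m))
    (hR : ∃ v s, Reach G (insert u X) u v ∧ j + 2 ≤ s ∧ s + 2 ≤ i + N ∧ G.Adj v (f s))
    (hA : ∃ m, i ≤ m ∧ m ≤ j ∧ G.Adj u (f m))
    (hi : ∃ m, i ≤ m ∧ m ≤ j ∧ ¬ (G.Adj u (f m) ↔ m = i))
    (hj : ∃ m, i ≤ m ∧ m ≤ j ∧ ¬ (G.Adj u (f m) ↔ m = j)) : False := by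
  have hlt := h.sec_lt hs
  obtain ⟨v, s, hv, hs1, hs2, hvs⟩ := hR
  obtain ⟨r, hr1, hr2, hwr⟩ := h.exists_far hs hij
  -- The far arc is added to `X`: it is anticomplete to the sector and contains the neighbor `f r`
  -- of `w`, which completes the link from `u` to `w`.
  refine link_false h.cls (h.ring.linearOn hlt) hij (w := w) (u := u)
    (X := X ∪ f '' Set.Icc (j + 2) (i + N - 2)) ?_ (fun m _ _ => (huH m).symm) huw huw' ?_ ?_
    hA hi hj
  · refine fun m h1 h2 => ⟨h.notMem m, fun e => ?_, ?_⟩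
    · by_contra hc
      exact hs.2.2.2 m (by omega) (by omega) e
    · rintro (rfl | rfl)
      exacts [hs.2.1, hs.2.2.1]
  · rintro x (hx | ⟨t, ⟨ht, ht'⟩, rfl⟩) m hm hm'
    · exact hX x hx m hm hm'
    · obtain ⟨h1, h2⟩ := h.ring.adj m t (by omega) (by omega)
      exact ⟨h1.symm, fun e => by have := h2.1 e.symm; omega⟩
  · have hmem : ∀ m, j + 2 ≤ m → m ≤ i + N - 2 →
        f m ∈ insert u (insert w (X ∪ f '' Set.Icc (j + 2) (i + N - 2))) :=
      fun m h1 h2 => Or.inr (Or.inr (Or.inr ⟨m, ⟨h1, h2⟩, rfl⟩))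
    have hsub : insert u X ⊆ insert u (insert w (X ∪ f '' Set.Icc (j + 2) (i + N - 2))) := by
      rintro x (rfl | hx)
      · simp
      · simp [hx]
    have hvmem : v ∈ insert u X := by
      obtain ⟨p, hp⟩ := hv
      exact hp v (by simp)
    refine (hv.mono hsub).trans (.trans (.of_adj hvs (hsub hvmem) (hmem s hs1 (by omega)))
      (.trans (?_ : Reach G _ _ (f r)) (.of_adj hwr.symm (hmem r hr1 (by omega)) (by simp))))
    exact (h.ring.linearOn (i := j + 2) (j := i + N - 2) (by omega)).reach hmem hs1 (by omega) hr1
      (by omega)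

end Wheel

/-! ### Attachments of a single vertex -/

lemma Ring.mem_Icc_of_mem_image {f : ℤ → V} {N c a b s : ℤ} (h : Ring G f N) (hca : c ≤ a)
    (hb : b < c + N) (hs : c ≤ s) (hs' : s < c + N) (hm : f s ∈ f '' Set.Icc a b) :
    a ≤ s ∧ s ≤ b := by
  obtain ⟨t, ⟨h1, h2⟩, e⟩ := hm
  rw [← h.inj (c := c) (by omega) (by omega) hs hs' e]
  exact ⟨h1, h2⟩

lemma Ring.image_Icc_shift {f : ℤ → V} {N : ℤ} (h : Ring G f N) (i j k : ℤ) :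
    f '' Set.Icc (i + N * k) (j + N * k) = f '' Set.Icc i j := by
  ext x
  constructor
  · rintro ⟨s, ⟨h1, h2⟩, rfl⟩
    refine ⟨s - N * k, ⟨by omega, by omega⟩, ?_⟩
    rw [← h.per_mul _ k, sub_add_cancel]
  · rintro ⟨s, ⟨h1, h2⟩, rfl⟩
    exact ⟨s + N * k, ⟨by omega, by omega⟩, h.per_mul _ _⟩

lemma Ring.not_adj_of_lt {f : ℤ → V} {N s t : ℤ} (h : Ring G f N) (h1 : s + 2 ≤ t)
    (h2 : t + 2 ≤ s + N) : f s ≠ f t ∧ ¬ G.Adj (f s) (f t) := by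
  obtain ⟨h3, h4⟩ := h.adj s t (by omega) (by omega)
  exact ⟨h3, fun e => by have := h4.1 e; omega⟩

namespace Wheel

variable {f : ℤ → V} {N : ℤ} {w : V}

/-- Two distinct nonadjacent common neighbors of `u` and `w` would form a square with them. -/
lemma common_nbr_cases (h : Wheel G f N w) {u : V} (huw : u ≠ w) (huw' : ¬ G.Adj u w) {s t : ℤ}
    (hus : G.Adj u (f s)) (hws : G.Adj w (f s)) (hut : G.Adj u (f t)) (hwt : G.Adj w (f t)) :
    f t = f s ∨ f t = f (s + 1) ∨ f t = f (s - 1) := by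
  by_contra hcon
  push Not at hcon
  refine square_false h.cls hus hws.symm hwt hut.symm huw huw' hcon.1.symm fun e => ?_
  rcases h.ring.adj_cases ⟨t, rfl⟩ e with e | e
  exacts [hcon.2.1 e, hcon.2.2 e]

/-- A vertex all of whose neighbors in the hole are neighbors of `w` attaches to one sector. -/
lemma sector_of_common_nbrs (h : Wheel G f N w) {u : V} (huw : u ≠ w) (huw' : ¬ G.Adj u w)
    (hall : ∀ m, G.Adj u (f m) → G.Adj w (f m)) :
    ∃ i j, Sec G f w i j ∧ ∀ m, G.Adj u (f m) → f m ∈ f '' Set.Icc i j := by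
  by_contra hbad
  push Not at hbad
  have h4 := h.ring.four_le
  obtain ⟨i₀, j₀, hs₀, -, -⟩ := h.exists_sec 0
  obtain ⟨m, hum, -⟩ := hbad i₀ j₀ hs₀
  have hwm := hall m hum
  obtain ⟨l, hl⟩ := h.sec_of_nbr hwm
  obtain ⟨e, m', he, he1, he2⟩ := h.exists_sec (m - 1)
  obtain rfl : m' = m := by
    by_contra hne
    exact he.2.2.2 m (by omega) (by omega) hwm
  have hl1 := hl.1
  obtain ⟨s, hus, hs⟩ := hbad _ _ hl
  obtain ⟨t, hut, ht⟩ := hbad _ _ he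
  rcases h.common_nbr_cases huw huw' hum hwm hus (hall s hus) with h1 | h1 | h1
  · exact hs ⟨m', ⟨le_rfl, by omega⟩, h1.symm⟩
  · exact hs ⟨m' + 1, ⟨by omega, by omega⟩, h1.symm⟩
  rcases h.common_nbr_cases huw huw' hum hwm hut (hall t hut) with h2 | h2 | h2
  · exact ht ⟨m', ⟨by omega, le_rfl⟩, h2.symm⟩
  -- The remaining case has both hole neighbors of `f m'` as common neighbors of `u` and `w`; they
  -- are nonadjacent, which gives a square.
  · have hws := hall s hus
    have hwt := hall t hut
    rw [h1] at hus hws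
    rw [h2] at hut hwt
    obtain ⟨h5, h6⟩ := h.ring.not_adj_of_lt (s := m' - 1) (t := m' + 1) (by omega) (by omega)
    exact square_false h.cls hus hws.symm hwt hut.symm huw huw' h5 h6
  · exact ht ⟨m' - 1, ⟨by omega, by omega⟩, h2.symm⟩

/-- This is `far_false` with nothing but `u` in the connected set; the interior neighbor `f m` shows
that the attachment is not confined to an end. -/
lemma not_adj_far (h : Wheel G f N w) {i j : ℤ} (hs : Sec G f w i j) {u : V}
    (huH : ∀ m, u ≠ f m) (huw : u ≠ w) (huw' : ¬ G.Adj u w) {m s : ℤ} (him : i < m) (hmj : m < j)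
    (hum : G.Adj u (f m)) (h1 : j + 2 ≤ s) (h2 : s + 2 ≤ i + N) : ¬ G.Adj u (f s) := fun hus =>
  h.far_false hs (by omega) (X := ∅) huH huw huw' (by simp)
    ⟨u, s, .refl (by simp), h1, h2, hus⟩ ⟨m, him.le, hmj.le, hum⟩
    ⟨m, him.le, hmj.le, fun e => by have := e.1 hum; omega⟩
    ⟨m, him.le, hmj.le, fun e => by have := e.1 hum; omega⟩

/-- The vertex `f (j + 1)` is interior to the next sector, so far attachments are excluded from that
side too. Only `f (j - 1)`, `f j`, `f (j + 1)`, `f (i - 1)` can be neighbors of `u`: with `f j` this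
is an even wheel, without it a square. -/
lemma both_sides_false [Finite V] (h : Wheel G f N w) {i j : ℤ} (hs : Sec G f w i j) {u : V}
    (huH : ∀ m, u ≠ f m) (huw : u ≠ w) (huw' : ¬ G.Adj u w) {m : ℤ} (him : i < m) (hmj : m < j)
    (hum : G.Adj u (f m)) (huj : G.Adj u (f (j + 1))) (hui : G.Adj u (f (i - 1)))
    (hwj : ¬ G.Adj w (f (j + 1))) : False := by
  have h4 := h.ring.four_le
  obtain ⟨l, hl⟩ := h.sec_of_nbr hs.2.2.1
  obtain ⟨r, hr1, hr2, hwr⟩ := h.exists_far hs (by omega)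
  have hl1 := hl.1
  have hlr : l ≤ r := by
    by_contra hc
    exact hl.2.2.2 r (by omega) (by omega) hwr
  have hlj : j + 2 ≤ l := by
    by_contra hc
    obtain rfl : l = j + 1 := by omega
    exact hwj hl.2.2.1
  have hui' : G.Adj u (f (i + N - 1)) := by
    rw [show i + N - 1 = i - 1 + N by omega, h.ring.per]; exact hui
  have hT : ∀ s, j + 2 ≤ s → s + 2 ≤ i + N → ¬ G.Adj u (f s) := fun s =>
    h.not_adj_far hs huH huw huw' him hmj hum
  have hS : ∀ s, l + 2 ≤ s → s + 2 ≤ j + N → ¬ G.Adj u (f s) := fun s =>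
    h.not_adj_far hl huH huw huw' (m := j + 1) (by omega) (by omega) huj
  -- The neighbor `f (i - 1)` of `u` must not be far from the sector `[j, l]`, while `f r` keeps `l`
  -- at distance at least 2 from `i + N`.
  have hli : l + 2 = i + N := by
    by_contra hc
    exact hS (i + N - 1) (by omega) (by omega) hui'
  have hlow : ∀ s, i ≤ s → s + 2 ≤ j → ¬ G.Adj u (f s) := by
    intro s h1 h2
    rw [← h.ring.per]
    exact hS _ (by omega) (by omega)
  obtain rfl : m = j - 1 := by
    by_contra hc
    exact hlow m (by omega) (by omega) hum
  by_cases hj : G.Adj u (f j)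
  · have hset : {t : ℤ | j - 1 ≤ t ∧ t < j - 1 + N ∧ G.Adj u (f t)} =
        ((insert (j - 1) (insert j (insert (j + 1) {i + N - 1})) : Finset ℤ) : Set ℤ) := by
      ext t
      simp only [Set.mem_ofPred_eq, Finset.coe_insert, Finset.coe_singleton, Set.mem_insert_iff,
        Set.mem_singleton_iff]
      constructor
      · rintro ⟨h1, h2, h3⟩
        by_contra hc
        by_cases h5 : t < i + N
        · exact hT t (by omega) (by omega) h3
        · rw [← sub_add_cancel t N, h.ring.per] at h3
          exact hlow _ (by omega) (by omega) h3
      · rintro (rfl | rfl | rfl | rfl)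
        exacts [⟨by omega, by omega, hum⟩, ⟨by omega, by omega, hj⟩, ⟨by omega, by omega, huj⟩,
          ⟨by omega, by omega, hui'⟩]
    have hcard : (G.neighborSet u ∩ Set.range f).ncard = 4 := by
      rw [h.ring.ncard_nbrs u (j - 1), hset, Set.ncard_coe_finset, Finset.card_insert_of_notMem,
        Finset.card_insert_of_notMem, Finset.card_insert_of_notMem, Finset.card_singleton] <;>
      simp only [Finset.mem_insert, Finset.mem_singleton] <;> omega
    obtain ⟨k, hk⟩ := not_even_nbrs h.cls h.ring.isHole
      (by rintro ⟨m, e⟩; exact huH m e.symm) (w := u) (by omega)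
    omega
  · obtain ⟨h5, h6⟩ := h.ring.not_adj_of_lt (s := j - 1) (t := j + 1) (by omega) (by omega)
    have h7 := h.ring.adj_succ (j - 1)
    rw [sub_add_cancel] at h7
    exact square_false h.cls hum h7 (h.ring.adj_succ j) huj.symm (huH j) hj h5 h6

/-- A vertex off the hole and nonadjacent to `w` attaches to one sector. -/
lemma sector_of_vertex [Finite V] (h : Wheel G f N w) {u : V}
    (huH : ∀ m, u ≠ f m) (huw : u ≠ w) (huw' : ¬ G.Adj u w) :
    ∃ i j, Sec G f w i j ∧ ∀ m, G.Adj u (f m) → f m ∈ f '' Set.Icc i j := by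
  by_cases hall : ∀ m, G.Adj u (f m) → G.Adj w (f m)
  · exact h.sector_of_common_nbrs huw huw' hall
  push Not at hall
  obtain ⟨m, hum, hwm⟩ := hall
  obtain ⟨i, j, hs, him, hmj⟩ := h.exists_sec m
  have him : i < m := lt_of_le_of_ne him (by rintro rfl; exact hwm hs.2.1)
  by_contra hbad
  push Not at hbad
  have hlt := h.sec_lt hs
  obtain ⟨r, hr1, hr2, -⟩ := h.exists_far hs (by omega)
  have hT : ∀ s, j + 2 ≤ s → s + 2 ≤ i + N → ¬ G.Adj u (f s) := fun s =>
    h.not_adj_far hs huH huw huw' him hmj hum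
  have hper : f (i + N - 1) = f (i - 1) := by
    rw [show i + N - 1 = i - 1 + N by omega, h.ring.per]
  by_cases huj : G.Adj u (f (j + 1)) <;> by_cases hui : G.Adj u (f (i - 1))
  · by_cases hwj : G.Adj w (f (j + 1))
    · by_cases hwi : G.Adj w (f (i - 1))
      · rw [← hper] at hui hwi
        obtain ⟨h5, h6⟩ := h.ring.not_adj_of_lt (s := j + 1) (t := i + N - 1) (by omega)
          (by omega)
        exact square_false h.cls huj hwj.symm hwi hui.symm huw huw' h5 h6
      · refine h.reflect.both_sides_false (i := -j) (j := -i) (m := -m) ?_ (fun m => huH _) huw huw'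
          (by omega) (by omega) (by simpa using hum) ?_ ?_ ?_
        · refine ⟨by omega, by simpa using hs.2.2.1, by simpa using hs.2.1, fun t h1 h2 => ?_⟩
          exact hs.2.2.2 (-t) (by omega) (by omega)
        · rwa [show -(-i + 1) = i - 1 by ring]
        · rwa [show -(-j - 1) = j + 1 by ring]
        · rwa [show -(-i + 1) = i - 1 by ring]
    · exact h.both_sides_false hs huH huw huw' him hmj hum huj hui hwj
  · obtain ⟨a, ha, ha', hua, hamin⟩ := exists_first (P := fun m => G.Adj u (f m)) (i := i) (j := j)
      ⟨m, him.le, hmj.le, hum⟩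
    have ham := hamin m him.le hmj.le hum
    -- The one-vertex path `u` replaces the arc from its first neighbor in the sector to `f (j +
    -- 1)`, and bypasses only the neighbor `f j` of `w`.
    refine h.bypass_false (Q := .nil) (a := a) (m := j) (b := j + 1) isIndPath_nil
      (by simpa using huH) (by simpa using ⟨huw, huw'⟩) (by omega) (by omega) (by omega)
      hs.2.2.1 ?_ hua huj ?_
    · intro s h1 h2 h3
      by_contra hc
      exact hs.2.2.2 s (by omega) (by omega) h3
    · intro x hx s h1 h2 hxs
      obtain rfl : x = u := by simpa using hx
      by_cases h3 : i + N ≤ s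
      · rw [← sub_add_cancel s N, h.ring.per] at hxs
        have := hamin _ (by omega) (by omega) hxs
        exact Or.inl ⟨rfl, by omega⟩
      · by_cases h5 : s = j + 1
        · exact Or.inr ⟨rfl, h5⟩
        by_cases h6 : s = i + N - 1
        · rw [h6, hper] at hxs
          exact absurd hxs hui
        · exact absurd hxs (hT s (by omega) (by omega))
  · obtain ⟨b, hb, hb', hub, hbmax⟩ := exists_last (P := fun m => G.Adj u (f m)) (i := i) (j := j)
      ⟨m, him.le, hmj.le, hum⟩
    have hbm := hbmax m him.le hmj.le hum
    refine h.bypass_false (Q := .nil) (a := i - 1) (m := i) (b := b) isIndPath_nil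
      (by simpa using huH) (by simpa using ⟨huw, huw'⟩) (by omega) (by omega) (by omega)
      hs.2.1 ?_ hui hub ?_
    · intro s h1 h2 h3
      by_contra hc
      exact hs.2.2.2 s (by omega) (by omega) h3
    · intro x hx s h1 h2 hxs
      obtain rfl : x = u := by simpa using hx
      by_cases h3 : s ≤ j
      · have := hbmax s (by omega) h3 hxs
        exact Or.inr ⟨rfl, by omega⟩
      by_cases h5 : s = j + 1
      · rw [h5] at hxs
        exact absurd hxs huj
      by_cases h6 : s = i - 1 + N
      · exact Or.inl ⟨rfl, h6⟩
      · exact absurd hxs (hT s (by omega) (by omega))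
  · obtain ⟨s', hus, hs'⟩ := hbad i j hs
    obtain ⟨s, -, h1, h2, h3, -⟩ := h.ring.exists_rep i s'
    rw [← h3] at hus hs'
    by_cases h5 : s ≤ j
    · exact hs' ⟨s, ⟨h1, h5⟩, rfl⟩
    by_cases h6 : s = j + 1
    · rw [h6] at hus
      exact huj hus
    by_cases h7 : s = i + N - 1
    · rw [h7, hper] at hus
      exact hui hus
    · exact hT s (by omega) (by omega) hus

end Wheel

/-! ### Paths attached to two sectors -/

/-- A path of `G \ N[w]`, disjoint from the hole, with at least two vertices, whose neighbors in the
hole are not all in one sector, while those of the path minus its last vertex are in the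
sector `[i, j]` and those of the path minus its first vertex are in the sector `[i', j']`. -/
structure Crossing (G : SimpleGraph V) (f : ℤ → V) (w : V) {p q : V} (Q : G.Walk p q)
    (i j i' j' : ℤ) : Prop where
  ind : IsIndPath Q
  offH : ∀ x ∈ Q.support, ∀ s, x ≠ f s
  offW : ∀ x ∈ Q.support, x ≠ w ∧ ¬ G.Adj x w
  ne : p ≠ q
  sec : Sec G f w i j
  sec' : Sec G f w i' j'
  left : ∀ x ∈ Q.support, x ≠ q → ∀ s, G.Adj x (f s) → f s ∈ f '' Set.Icc i j
  right : ∀ x ∈ Q.support, x ≠ p → ∀ s, G.Adj x (f s) → f s ∈ f '' Set.Icc i' j'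
  bad : ∀ a b, Sec G f w a b → ∃ x ∈ Q.support, ∃ s, G.Adj x (f s) ∧ f s ∉ f '' Set.Icc a b

namespace Crossing

variable {f : ℤ → V} {N : ℤ} {w p q : V} {Q : G.Walk p q} {i j i' j' : ℤ}

lemma reverse (c : Crossing G f w Q i j i' j') : Crossing G f w Q.reverse i' j' i j where
  ind := c.ind.reverse
  offH x hx := c.offH x (by simpa using hx)
  offW x hx := c.offW x (by simpa using hx)
  ne := c.ne.symm
  sec := c.sec'
  sec' := c.sec
  left x hx := c.right x (by simpa using hx)
  right x hx := c.left x (by simpa using hx)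
  bad a b hs := by
    obtain ⟨x, hx, h⟩ := c.bad a b hs
    exact ⟨x, by simpa using hx, h⟩

lemma shift (h : Wheel G f N w) (c : Crossing G f w Q i j i' j') (k : ℤ) :
    Crossing G f w Q i j (i' + N * k) (j' + N * k) where
  ind := c.ind
  offH := c.offH
  offW := c.offW
  ne := c.ne
  sec := c.sec
  sec' := h.sec_shift c.sec' k
  left := c.left
  right := by rw [h.ring.image_Icc_shift]; exact c.right
  bad := c.bad

/-- All vertices of `Q` but `p` attach inside `[i', j']`, so only `p` can witness that this sector
is bad. -/
lemma exists_left (c : Crossing G f w Q i j i' j') :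
    ∃ s, G.Adj p (f s) ∧ f s ∈ f '' Set.Icc i j ∧ f s ∉ f '' Set.Icc i' j' := by
  obtain ⟨x, hx, s, h1, h2⟩ := c.bad _ _ c.sec'
  obtain rfl : x = p := by
    by_contra hne
    exact h2 (c.right x hx hne s h1)
  exact ⟨s, h1, c.left x hx c.ne s h1, h2⟩

lemma exists_left' (c : Crossing G f w Q i j i' j') :
    ∃ s, i ≤ s ∧ s ≤ j ∧ G.Adj p (f s) ∧ f s ∉ f '' Set.Icc i' j' := by
  obtain ⟨s, h1, ⟨t, ⟨h3, h4⟩, h5⟩, h2⟩ := c.exists_left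
  rw [← h5] at h1 h2
  exact ⟨t, h3, h4, h1, h2⟩

lemma exists_right' (c : Crossing G f w Q i j i' j') :
    ∃ s, i' ≤ s ∧ s ≤ j' ∧ G.Adj q (f s) ∧ f s ∉ f '' Set.Icc i j :=
  c.reverse.exists_left'

lemma left_le (h : Wheel G f N w) (c : Crossing G f w Q i j i' j') {x : V} (hx : x ∈ Q.support)
    (hxq : x ≠ q) {s : ℤ} (his : i ≤ s) (hs : s < i + N) (hxs : G.Adj x (f s)) : s ≤ j :=
  (h.ring.mem_Icc_of_mem_image le_rfl (by have := h.sec_lt c.sec; omega) his hs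
    (c.left x hx hxq s hxs)).2

/-- Going from the first neighbor of `p` in `[i, j]` along `Q` to the last neighbor of `q` in `[j,
l]` bypasses exactly one neighbor of `w`, namely `f j`. -/
lemma share_false [Finite V] (h : Wheel G f N w) {l : ℤ} (c : Crossing G f w Q i j j l) :
    False := by
  have hij := c.sec.1
  have hjl := c.sec'.1
  have hli : l < i + N := by
    obtain ⟨r, h1, h2, h3, h4, h5⟩ := h.exists_third i i j
    by_contra hc
    rcases lt_or_gt_of_ne h5 with h6 | h6
    · exact c.sec.2.2.2 r (by omega) h6 h3
    · exact c.sec'.2.2.2 r h6 (by omega) h3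
  obtain ⟨s, hs, hs', hps, hsn⟩ := c.exists_left'
  obtain ⟨t, ht, ht', hqt, htn⟩ := c.exists_right'
  have hsj : s ≠ j := by rintro rfl; exact hsn ⟨s, ⟨le_rfl, by omega⟩, rfl⟩
  have htj : t ≠ j := by rintro rfl; exact htn ⟨t, ⟨by omega, le_rfl⟩, rfl⟩
  obtain ⟨a, ha, ha', hpa, hamin⟩ := exists_first (P := fun m => G.Adj p (f m)) (i := i) (j := j)
    ⟨s, hs, hs', hps⟩
  obtain ⟨b, hb, hb', hqb, hbmax⟩ := exists_last (P := fun m => G.Adj q (f m)) (i := j) (j := l)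
    ⟨t, ht, ht', hqt⟩
  have has := hamin s hs hs' hps
  have hbt := hbmax t ht ht' hqt
  refine h.bypass_false c.ind c.offH c.offW (a := a) (m := j) (b := b) (by omega) (by omega)
    (by omega) c.sec.2.2.1 ?_ hpa hqb ?_
  · intro m h1 h2 h3
    by_contra hne
    rcases lt_or_gt_of_ne hne with h4 | h4
    · exact c.sec.2.2.2 m (by omega) h4 h3
    · exact c.sec'.2.2.2 m h4 (by omega) h3
  · intro x hx m h1 h2 hxm
    by_cases h3 : m < i + N
    · right
      obtain rfl : x = q := by
        by_contra hne
        have := c.left_le h hx hne (by omega) h3 hxm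
        omega
      have := (h.ring.mem_Icc_of_mem_image (c := i) (by omega) hli (by omega) h3
        (c.right x hx c.ne.symm m hxm)).2
      have := hbmax m (by omega) this hxm
      exact ⟨rfl, by omega⟩
    · left
      rw [← sub_add_cancel m N, h.ring.per] at hxm
      obtain rfl : x = p := by
        by_contra hne
        have := (h.ring.mem_Icc_of_mem_image (c := i) (by omega) hli (by omega) (by omega)
          (c.right x hx hne _ hxm)).1
        omega
      have := hamin _ (by omega) (by omega) hxm
      exact ⟨rfl, by omega⟩

/-- Interior vertices of `Q` attach inside both sectors, which are disjoint here, so they do not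
attach at all. -/
lemma right_mem (h : Wheel G f N w) (c : Crossing G f w Q i j i' j') (hi : j < i')
    (hj : j' < i + N) {x : V} (hx : x ∈ Q.support) (hxp : x ≠ p) {s : ℤ} (his : i ≤ s)
    (hs : s < i + N) (hxs : G.Adj x (f s)) : x = q ∧ i' ≤ s ∧ s ≤ j' := by
  have hij := c.sec.1
  have h1 := h.ring.mem_Icc_of_mem_image (by omega) hj his hs (c.right x hx hxp s hxs)
  refine ⟨?_, h1⟩
  by_contra hne
  have := c.left_le h hx hne his hs hxs
  omega

/-- The linking argument is applied to `H` itself, with the unique neighbor `f t` of `q` in the role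
of `w`: the rest of `Q` links `p` to `f t` and misses the rest of `H`. -/
lemma single_false (h : Wheel G f N w) (c : Crossing G f w Q i j i' j') (hi : j < i')
    (hj : j' < i + N) (k : ℤ) (hk : ∀ s, i' ≤ s → s ≤ j' → G.Adj q (f s) → s = k) : False := by
  have h4 := h.ring.four_le
  have hij := c.sec.1
  obtain ⟨t, ht, ht', hqt, -⟩ := c.exists_right'
  obtain rfl := hk t ht ht' hqt
  obtain ⟨s, hs, hs', hps, -⟩ := c.exists_left'
  have hps' : G.Adj p (f (s + N)) := by rw [h.ring.per]; exact hps
  have hpm : p ∈ Q.support := by simp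
  have hbad : ∀ a b, Sec G f w a b → f t ∈ f '' Set.Icc a b →
      ∃ s, G.Adj p (f s) ∧ f s ∉ f '' Set.Icc a b := by
    intro a b hab hta
    obtain ⟨x, hx, s', h1, h2⟩ := c.bad a b hab
    obtain ⟨s, -, h5, h6, h7, -⟩ := h.ring.exists_rep i s'
    rw [← h7] at h1 h2
    by_cases hxp : x = p
    · subst hxp
      exact ⟨s, h1, h2⟩
    · obtain ⟨rfl, h8, h9⟩ := c.right_mem h hi hj hx hxp h5 h6 h1
      rw [hk s h8 h9 h1] at h2
      exact absurd hta h2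
  have hrep : ∀ s, G.Adj p (f s) → ∃ m, t < m ∧ m < t + N ∧ f m = f s := by
    intro s hs
    obtain ⟨m, -, h1, h2, h3, -⟩ := h.ring.exists_rep t s
    refine ⟨m, lt_of_le_of_ne h1 ?_, h2, h3⟩
    rintro rfl
    rw [← h3] at hs
    have := c.left_le h hpm c.ne (by omega) (by omega) hs
    omega
  refine link_false h.cls (h.ring.linearOn (i := t + 1) (j := t + N - 1) (by omega)) (by omega)
    (w := f t) (u := p) (X := {x | x ∈ Q.support ∧ x ≠ p}) ?_ (fun m _ _ => (c.offH p hpm m).symm)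
    (c.offH p hpm t) ?_ ?_ ?_ ⟨s + N, by omega, by omega, hps'⟩ ?_ ?_
  · intro m h1 h2
    obtain ⟨h5, h6⟩ := h.ring.adj t m (by omega) (by omega)
    refine ⟨h5.symm, h6.trans ?_⟩
    constructor <;> omega
  · intro e
    have := c.left_le h hpm c.ne (by omega) (by omega) e
    omega
  · rintro x ⟨hx, hxp⟩ m h1 h2
    refine ⟨c.offH x hx m, fun e => ?_⟩
    by_cases h3 : m < i + N
    · obtain ⟨rfl, h5, h6⟩ := c.right_mem h hi hj hx hxp (by omega) h3 e
      have := hk m h5 h6 e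
      omega
    · rw [← sub_add_cancel m N, h.ring.per] at e
      obtain ⟨rfl, h5, h6⟩ := c.right_mem h hi hj hx hxp (by omega) (by omega) e
      have := hk _ h5 h6 e
      omega
  · have hQ : Reach G (insert p (insert (f t) {x | x ∈ Q.support ∧ x ≠ p})) p q := by
      refine ⟨Q, fun x hx => ?_⟩
      by_cases hxp : x = p
      · exact Or.inl hxp
      · exact Or.inr (Or.inr ⟨hx, hxp⟩)
    exact hQ.trans (.of_adj hqt (Or.inr (Or.inr ⟨by simp, c.ne.symm⟩)) (by simp))
  -- If `p` sees only `f (t + 1)` besides possibly `f t`, disjointness forces `t = j'` and `t + 1 =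
  -- i + N`. Then `[t, t + 1]` is a sector containing all attachments of `Q`, against `bad`. The
  -- other end is symmetric.
  · by_contra hcon
    push Not at hcon
    have h5 := (hcon (s + N) (by omega) (by omega)).1 hps'
    have hseq : Sec G f w t (t + 1) := by
      refine ⟨by omega, ?_, ?_, fun m _ _ => by omega⟩
      · rw [show t = j' by omega]; exact c.sec'.2.2.1
      · rw [show t + 1 = i + N by omega, h.ring.per]; exact c.sec.2.1
    obtain ⟨s', h6, h7⟩ := hbad _ _ hseq ⟨t, ⟨le_rfl, by omega⟩, rfl⟩
    obtain ⟨m, h8, h9, h10⟩ := hrep s' h6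
    rw [← h10] at h6 h7
    have := (hcon m (by omega) (by omega)).1 h6
    exact h7 ⟨m, ⟨by omega, by omega⟩, rfl⟩
  · by_contra hcon
    push Not at hcon
    have h5 := (hcon (s + N) (by omega) (by omega)).1 hps'
    have hseq : Sec G f w (t - 1) t := by
      refine ⟨by omega, ?_, ?_, fun m _ _ => by omega⟩
      · rw [show t - 1 = j by omega]; exact c.sec.2.2.1
      · rw [show t = i' by omega]; exact c.sec'.2.1
    obtain ⟨s', h6, h7⟩ := hbad _ _ hseq ⟨t, ⟨by omega, le_rfl⟩, rfl⟩
    obtain ⟨m, h8, h9, h10⟩ := hrep s' h6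
    rw [← h10] at h6 h7
    have := (hcon m (by omega) (by omega)).1 h6
    refine h7 ⟨t - 1, ⟨by omega, by omega⟩, ?_⟩
    rw [← h.ring.per]; congr 1; omega

/-- By `far_false`, `q` can see only the two vertices of `H` just outside `[i, j]`. It cannot see
both, since its sector would contain the far neighbor of `w` in its interior; so `single_false`
applies. -/
lemma generic_false (h : Wheel G f N w) (c : Crossing G f w Q i j i' j') (hi : j < i')
    (hj : j' < i + N) (hij : i + 2 ≤ j)
    (hai : ∃ m, i ≤ m ∧ m ≤ j ∧ ¬ (G.Adj p (f m) ↔ m = i))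
    (haj : ∃ m, i ≤ m ∧ m ≤ j ∧ ¬ (G.Adj p (f m) ↔ m = j)) : False := by
  have hpm : p ∈ Q.support := by simp
  obtain ⟨s, hs, hs', hps, -⟩ := c.exists_left'
  have hfar : ∀ t, j + 2 ≤ t → t + 2 ≤ i + N → ¬ G.Adj q (f t) := by
    intro t h1 h2 hqt
    refine h.far_false c.sec hij (u := p) (X := {x | x ∈ Q.support ∧ x ≠ p}) (c.offH p hpm)
      (c.offW p hpm).1 (c.offW p hpm).2 ?_ ⟨q, t, ⟨Q, fun x hx => ?_⟩, h1, h2, hqt⟩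
      ⟨s, hs, hs', hps⟩ hai haj
    · rintro x ⟨hx, hxp⟩ m h3 h4
      refine ⟨c.offH x hx m, fun e => ?_⟩
      have := c.right_mem h hi hj hx hxp h3 (by omega) e
      omega
    · by_cases hxp : x = p
      · exact Or.inl hxp
      · exact Or.inr ⟨hx, hxp⟩
  have hcase : ∀ t, i' ≤ t → t ≤ j' → G.Adj q (f t) → t = j + 1 ∨ t = i + N - 1 := by
    intro t h1 h2 h3
    by_contra hc
    exact hfar t (by omega) (by omega) h3
  by_cases hq1 : i' ≤ j + 1 ∧ G.Adj q (f (j + 1))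
  · refine c.single_false h hi hj (j + 1) fun t h1 h2 h3 => ?_
    rcases hcase t h1 h2 h3 with h5 | h5
    · exact h5
    · exfalso
      obtain ⟨r, h6, h7, h8⟩ := h.exists_far c.sec hij
      exact c.sec'.2.2.2 r (by omega) (by omega) h8
  · refine c.single_false h hi hj (i + N - 1) fun t h1 h2 h3 => ?_
    rcases hcase t h1 h2 h3 with h5 | h5
    · rw [h5] at h1 h3
      exact absurd ⟨h1, h3⟩ hq1
    · exact h5

/-- By `single_false` for the reversed path, `p` has two neighbors in its sector, so its attachment
is not confined to an end and `generic_false` excludes a long sector. -/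
lemma left_pair (h : Wheel G f N w) (c : Crossing G f w Q i j i' j') (hi : j < i')
    (hj : j' < i + N) : j = i + 1 ∧ G.Adj p (f i) ∧ G.Adj p (f j) := by
  have hij := c.sec.1
  have hij' := c.sec'.1
  have c' := c.reverse.shift h 1
  rw [mul_one] at c'
  have hsingle : ∀ k, (∀ s, i ≤ s → s ≤ j → G.Adj p (f s) → s = k) → False := by
    intro k hk
    refine c'.single_false h hj (by omega) (k + N) fun s h1 h2 h3 => ?_
    rw [← sub_add_cancel s N, h.ring.per] at h3
    have := hk _ (by omega) (by omega) h3
    omega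
  have hj1 : j = i + 1 := by
    by_contra hne
    refine c.generic_false h hi hj (by omega) ?_ ?_
    · by_contra hcon
      push Not at hcon
      exact hsingle i fun s h1 h2 h3 => (hcon s h1 h2).1 h3
    · by_contra hcon
      push Not at hcon
      exact hsingle j fun s h1 h2 h3 => (hcon s h1 h2).1 h3
  refine ⟨hj1, ?_, ?_⟩
  · by_contra hp
    refine hsingle j fun s h1 h2 h3 => ?_
    by_contra hne
    rw [show s = i by omega] at h3
    exact hp h3
  · by_contra hp
    refine hsingle i fun s h1 h2 h3 => ?_
    by_contra hne
    rw [show s = j by omega] at h3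
    exact hp h3

/-- Both sectors are edges, forming triangles with `p` and `q`. The prism consists of `Q` and the
two arcs of `H` between these edges. -/
lemma disjoint_false (h : Wheel G f N w) (c : Crossing G f w Q i j i' j') (hi : j < i')
    (hj : j' < i + N) : False := by
  obtain ⟨hj1, hpi, hpj⟩ := c.left_pair h hi hj
  have c' := c.reverse.shift h 1
  rw [mul_one] at c'
  obtain ⟨hj1', hqi, hqj⟩ := c'.left_pair h hj (by omega)
  have hpm : p ∈ Q.support := by simp
  have hrange : ∀ x ∈ Q.support, ∀ s, i ≤ s → s < i + N → G.Adj x (f s) →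
      (x = p ∧ s ≤ j) ∨ (x = q ∧ i' ≤ s ∧ s ≤ j') := by
    intro x hx s h1 h2 h3
    by_cases hxp : x = p
    · subst hxp
      exact Or.inl ⟨rfl, c.left_le h hx c.ne h1 h2 h3⟩
    · exact Or.inr (c.right_mem h hi hj hx hxp h1 h2 h3)
  have hN := h.ring.per i
  refine prism_false h.cls (a₁ := p) (b₁ := q) (a₂ := f j) (b₂ := f i') (a₃ := f (i + N))
    (b₃ := f j') (X := {x | x ∈ Q.support}) (Y := f '' Set.Icc j i')
    (Z := f '' Set.Icc j' (i + N)) c.ne (h.ring.adj j i' hi (by omega)).1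
    (h.ring.adj j' (i + N) hj (by omega)).1.symm hpj (by rw [hN]; exact hpi) ?_ hqi hqj ?_
    ?_ ?_ ?_ ⟨Q, fun x hx => hx⟩ ?_ ?_
  · rw [hN, hj1]; exact (h.ring.adj_succ i).symm
  · rw [hj1']; exact h.ring.adj_succ i'
  · rintro x hx _ ⟨s, ⟨hs, hs'⟩, rfl⟩
    refine ⟨c.offH x hx s, fun e => ?_⟩
    rcases hrange x hx s (by omega) (by omega) e with ⟨rfl, h1⟩ | ⟨rfl, h1, h2⟩
    · exact Or.inl ⟨rfl, by rw [show s = j by omega]⟩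
    · exact Or.inr ⟨rfl, by rw [show s = i' by omega]⟩
  · rintro x hx _ ⟨s, ⟨hs, hs'⟩, rfl⟩
    refine ⟨c.offH x hx s, fun e => ?_⟩
    rcases eq_or_lt_of_le hs' with rfl | hs'
    · rw [hN] at e
      rcases hrange x hx i (by omega) (by omega) e with ⟨rfl, h1⟩ | ⟨rfl, h1, h2⟩
      · exact Or.inl ⟨rfl, rfl⟩
      · omega
    · rcases hrange x hx s (by omega) (by omega) e with ⟨rfl, h1⟩ | ⟨rfl, h1, h2⟩
      · omega
      · exact Or.inr ⟨rfl, by rw [show s = j' by omega]⟩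
  · rintro _ ⟨s, ⟨hs, hs'⟩, rfl⟩ _ ⟨t, ⟨ht, ht'⟩, rfl⟩
    obtain ⟨h1, h2⟩ := h.ring.adj s t (by omega) (by omega)
    refine ⟨h1, fun e => ?_⟩
    rcases h2.1 e with h3 | h3
    · exact Or.inr ⟨by rw [show s = i' by omega], by rw [show t = j' by omega]⟩
    · exact Or.inl ⟨by rw [show s = j by omega], by rw [show t = i + N by omega]⟩
  · exact (h.ring.linearOn (i := j) (j := i') (by omega)).reach
      (fun m h1 h2 => ⟨m, ⟨h1, h2⟩, rfl⟩) le_rfl hi.le hi.le le_rfl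
  · exact (h.ring.linearOn (i := j') (j := i + N) (by omega)).reach
      (fun m h1 h2 => ⟨m, ⟨h1, h2⟩, rfl⟩) hj.le le_rfl le_rfl hj.le

end Crossing

/-! ### Attachments of induced paths -/

/-- The vertices of the hole that are in `X` or have a neighbor in `X` are all in one sector. -/
def InSector (G : SimpleGraph V) (f : ℤ → V) (w : V) (X : Set V) : Prop :=
  ∃ i j, Sec G f w i j ∧ ∀ x ∈ X, ∀ s, f s = x ∨ G.Adj x (f s) → f s ∈ f '' Set.Icc i j

namespace Wheel

variable {f : ℤ → V} {N : ℤ} {w : V}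

/-- Sectors have no neighbor of `w` inside, so they cannot overlap partially: up to a multiple of
`N`, a second sector is the first one or fits in the complementary arc. -/
lemma mem_sector_normalize (h : Wheel G f N w) {i j i₁ j₁ : ℤ} (hs : Sec G f w i j)
    (hs₁ : Sec G f w i₁ j₁) :
    ∃ k, i₁ + N * k = i ∧ j₁ + N * k = j ∨ j ≤ i₁ + N * k ∧ j₁ + N * k ≤ i + N := by
  obtain ⟨i', k, h1, h2, -, h3⟩ := h.ring.exists_rep i i₁
  have hs' := h.sec_shift hs₁ (-k)
  have h4 : N * -k = -(N * k) := by ring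
  refine ⟨-k, ?_⟩
  rw [h4] at hs' ⊢
  by_cases h5 : i₁ + -(N * k) = i
  · exact Or.inl ⟨h5, hs'.right_eq hs h5⟩
  · right
    constructor
    · by_contra hc
      exact hs.2.2.2 _ (by omega) (by omega) hs'.2.1
    · by_contra hc
      refine hs'.2.2.2 (i + N) (by omega) (by omega) ?_
      rw [h.ring.per]; exact hs.2.1

lemma inSector_singleton [Finite V] (h : Wheel G f N w) {u : V} (huw : u ≠ w)
    (huw' : ¬ G.Adj u w) : InSector G f w {u} := by
  by_cases hu : ∃ m, u = f m
  · obtain ⟨m, rfl⟩ := hu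
    obtain ⟨i, j, hs, him, hmj⟩ := h.exists_sec m
    have him : i < m := lt_of_le_of_ne him (by rintro rfl; exact huw' hs.2.1.symm)
    refine ⟨i, j, hs, ?_⟩
    rintro _ rfl s (e | e)
    · exact ⟨m, ⟨him.le, hmj.le⟩, e.symm⟩
    · rcases h.ring.adj_cases ⟨s, rfl⟩ e with e | e
      · exact ⟨m + 1, ⟨by omega, by omega⟩, e.symm⟩
      · exact ⟨m - 1, ⟨by omega, by omega⟩, e.symm⟩
  · push Not at hu
    obtain ⟨i, j, hs, hm⟩ := h.sector_of_vertex hu huw huw'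
    refine ⟨i, j, hs, ?_⟩
    rintro _ rfl s (e | e)
    · exact absurd e.symm (hu s)
    · exact hm s e

lemma isIndPath_of_concat {u v t : V} {p : G.Walk u v} {h : G.Adj v t}
    (hp : IsIndPath (p.concat h)) : IsIndPath p ∧ t ∉ p.support := by
  have := hp.reverse
  rw [Walk.reverse_concat, isIndPath_cons] at this
  refine ⟨?_, by simpa using this.2.1⟩
  simpa using this.1.reverse

/-- An induced path of `G \ N[w]` attaches to only one sector. -/
lemma inSector_of_path [Finite V] (h : Wheel G f N w) (n : ℕ) {p q : V} (Q : G.Walk p q)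
    (hQ : IsIndPath Q) (hn : Q.length = n) (hQw : ∀ x ∈ Q.support, x ≠ w ∧ ¬ G.Adj x w) :
    InSector G f w {x | x ∈ Q.support} := by
  induction n generalizing p q with
  | zero =>
    cases Q with
    | nil =>
      have := hQw p (by simp)
      simpa using h.inSector_singleton this.1 this.2
    | cons => simp at hn
  | succ n ih =>
    cases Q with
    | nil => simp at hn
    | @cons _ v _ hpv Q₁ =>
      obtain ⟨z, Q₀, hzq, hc⟩ := Walk.exists_cons_eq_concat hpv Q₁
      have hQ₁ := (isIndPath_cons _ _).1 hQ
      have hQ₀ := hQ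
      rw [hc] at hQ₀
      replace hQ₀ := isIndPath_of_concat hQ₀
      have hmem₁ : ∀ x, x ∈ (Walk.cons hpv Q₁).support ↔ x = p ∨ x ∈ Q₁.support := by simp
      have hmem₀ : ∀ x, x ∈ (Walk.cons hpv Q₁).support ↔ x = q ∨ x ∈ Q₀.support := by
        intro x
        rw [hc, Walk.support_concat]
        simp [or_comm]
      have hl₀ : Q₀.length = n := by
        have := congrArg Walk.length hc
        rw [Walk.length_concat] at this
        omega
      obtain ⟨i₁, j₁, hs₁, hS⟩ := ih Q₁ hQ₁.1 (by simpa using hn)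
        (fun x hx => hQw x ((hmem₁ x).2 (Or.inr hx)))
      obtain ⟨i, j, hs, hT⟩ := ih Q₀ hQ₀.1 hl₀ (fun x hx => hQw x ((hmem₀ x).2 (Or.inr hx)))
      by_contra hbad
      have hne : p ≠ q := by
        rintro rfl
        exact hQ₁.2.1 (by simp)
      have hpQ₀ : p ∈ Q₀.support := by simp
      have hqQ₁ : q ∈ Q₁.support := by simp
      obtain ⟨k, hk⟩ := h.mem_sector_normalize hs hs₁
      rw [← h.ring.image_Icc_shift i₁ j₁ k] at hS
      replace hs₁ := h.sec_shift hs₁ k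
      generalize i₁ + N * k = i₁, j₁ + N * k = j₁ at hS hs₁ hk
      rcases hk with ⟨rfl, rfl⟩ | ⟨hk1, hk2⟩
      · refine hbad ⟨_, _, hs, fun x hx => ?_⟩
        rcases (hmem₁ x).1 hx with rfl | hx
        · exact hT _ hpQ₀
        · exact hS x hx
      -- A hole vertex on the path, or one of its path neighbors, belongs to each of the two shorter
      -- paths, so the vertex lies in both sectors. It would be a common end of them, hence adjacent
      -- to `w`.
      have offH : ∀ x ∈ (Walk.cons hpv Q₁).support, ∀ s, x ≠ f s := by
        rintro x hx s rfl
        have hws : ¬ G.Adj w (f s) := fun e => (hQw _ hx).2 e.symm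
        have h1 : f s ∈ f '' Set.Icc i j := by
          rcases (hmem₀ _).1 hx with e | hx'
          · exact hT z (by simp) s (Or.inr (by rw [e]; exact hzq))
          · exact hT _ hx' s (Or.inl rfl)
        have h2 : f s ∈ f '' Set.Icc i₁ j₁ := by
          rcases (hmem₁ _).1 hx with e | hx'
          · exact hS v (by simp) s (Or.inr (by rw [e]; exact hpv.symm))
          · exact hS _ hx' s (Or.inl rfl)
        obtain ⟨a, ⟨ha, ha'⟩, e⟩ := h1
        obtain ⟨b, ⟨hb, hb'⟩, e'⟩ := h2
        have ha1 : a ≠ j := by rintro rfl; rw [← e] at hws; exact hws hs.2.2.1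
        have hb1 : b ≠ j₁ := by rintro rfl; rw [← e'] at hws; exact hws hs₁.2.2.1
        have hlt := h.sec_lt hs
        have := h.ring.inj (c := i) ha (by omega) (by omega) (by omega) (e.trans e'.symm)
        omega
      have c : Crossing G f w (Walk.cons hpv Q₁) i j i₁ j₁ := by
        refine ⟨hQ, offH, hQw, hne, hs, hs₁, ?_, ?_, ?_⟩
        · intro x hx hxq s e
          exact hT x (((hmem₀ x).1 hx).resolve_left hxq) s (Or.inr e)
        · intro x hx hxp s e
          exact hS x (((hmem₁ x).1 hx).resolve_left hxp) s (Or.inr e)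
        · intro a b hab
          by_contra hcon
          push Not at hcon
          refine hbad ⟨a, b, hab, ?_⟩
          rintro x hx s (e | e)
          · exact absurd e.symm (offH x hx s)
          · exact hcon x hx s e
      rcases eq_or_lt_of_le hk1 with rfl | hk1
      · exact c.share_false h
      rcases eq_or_lt_of_le hk2 with rfl | hk2
      -- The shared end is now `f i = f (i + N)`; reversing and shifting by one period makes it the
      -- right end of the first sector.
      · have c' := c.reverse.shift h 1
        rw [mul_one] at c'
        exact c'.share_false h
      · exact c.disjoint_false h hk1 hk2

end Wheel

/-! ### Components of G \ N[w] -/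

lemma reach_of_mem_component {K : Set V} (D : G.ComponentCompl K) {x y : V} (hx : x ∈ D.supp)
    (hy : y ∈ D.supp) : Reach G D.supp x y := by
  obtain ⟨hxK, hxD⟩ := hx
  obtain ⟨hyK, hyD⟩ := hy
  obtain ⟨p⟩ := ConnectedComponent.exact (hxD.trans hyD.symm)
  have key : ∀ {a b : (Kᶜ : Set V)} (p : (G.induce Kᶜ).Walk a b), a.1 ∈ D.supp →
      Reach G D.supp a.1 b.1 := by
    intro a b p
    induction p with
    | nil => exact fun h => .refl h
    | @cons a b c hab p ih =>
      intro ha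
      have hb : b.1 ∈ D.supp := ComponentCompl.mem_of_adj a.1 b.1 ha b.2 hab
      exact (Reach.of_adj (G := G) hab ha hb).trans (ih hb)
  exact key p ⟨hxK, hxD⟩

lemma Ring.eq_add_mul {f : ℤ → V} {N s t : ℤ} (h : Ring G f N) (e : f s = f t) :
    ∃ k, s = t + N * k := by
  have := h.four_le
  obtain ⟨m, k, h1, h2, h3, h4⟩ := h.exists_rep t s
  have := h.inj h1 h2 le_rfl (by omega) (h3.trans e)
  exact ⟨k, by omega⟩

namespace Wheel

variable {f : ℤ → V} {N : ℤ} {w : V}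

/-- The two ends of a sector are the only neighbors of `w` in it. -/
lemma eq_end_of_mem (h : Wheel G f N w) {a b m : ℤ} (hs : Sec G f w a b) (hm : G.Adj w (f m))
    (hmem : f m ∈ f '' Set.Icc a b) : f m = f a ∨ f m = f b := by
  have := h.ring.four_le
  obtain ⟨t, ⟨h1, h2⟩, e⟩ := hmem
  rw [← e] at hm ⊢
  rcases eq_or_lt_of_le h1 with rfl | h1
  · exact Or.inl rfl
  rcases eq_or_lt_of_le h2 with rfl | h2
  · exact Or.inr rfl
  · exact absurd hm (hs.2.2.2 t h1 h2)

lemma end_of_start (h : Wheel G f N w) {a b m l : ℤ} (hs : Sec G f w a b) (hl : Sec G f w m l)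
    (e : f m = f a) : f l = f b := by
  obtain ⟨k, rfl⟩ := h.ring.eq_add_mul e
  rw [hl.right_eq (h.sec_shift hs k) rfl, h.ring.per_mul]

lemma start_of_end (h : Wheel G f N w) {a b m l : ℤ} (hs : Sec G f w a b) (hl : Sec G f w l m)
    (e : f m = f b) : f l = f a := by
  obtain ⟨k, rfl⟩ := h.ring.eq_add_mul e
  have hs' := h.sec_shift hs k
  rw [← h.ring.per_mul a k]
  rcases lt_trichotomy l (a + N * k) with h1 | h1 | h1
  · exact absurd hs'.2.1 (hl.2.2.2 _ h1 hs'.1)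
  · rw [h1]
  · exact absurd hl.2.1 (hs'.2.2.2 _ h1 hl.1)

/-- A connected set `D` closed under adjacency in `G \ N[w]` attaches to the ends of a single
sector. -/
lemma exists_sector [Finite V] (h : Wheel G f N w) {D : Set V}
    (hDw : ∀ x ∈ D, x ≠ w ∧ ¬ G.Adj x w)
    (hDadj : ∀ x ∈ D, ∀ y, G.Adj x y → y ≠ w → ¬ G.Adj w y → y ∈ D)
    (hDreach : ∀ x ∈ D, ∀ y ∈ D, Reach G D x y) :
    ∃ i j, Sec G f w i j ∧ ∀ m, f m ∈ nbhd G D → f m = f i ∨ f m = f j := by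
  have hpair : ∀ x ∈ D, ∀ y ∈ D, ∃ a b, Sec G f w a b ∧ ∀ z, z = x ∨ z = y →
      ∀ s, f s = z ∨ G.Adj z (f s) → f s ∈ f '' Set.Icc a b := by
    intro x hx y hy
    obtain ⟨Q, hQ, hQD⟩ := (hDreach x hx y hy).exists_indPath
    obtain ⟨a, b, hs, hab⟩ := h.inSector_of_path _ Q hQ rfl fun z hz => hDw z (hQD z hz)
    refine ⟨a, b, hs, ?_⟩
    rintro z (rfl | rfl)
    · exact hab _ (by simp)
    · exact hab _ (by simp)
  have hYw : ∀ m, f m ∈ nbhd G D → G.Adj w (f m) := by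
    rintro m ⟨hm, d, hd, hmd⟩
    by_contra hw
    exact hm (hDadj d hd _ hmd.symm (h.notMem m) hw)
  have hends : ∀ m s, f m ∈ nbhd G D → f s ∈ nbhd G D → ∃ a b, Sec G f w a b ∧
      (f m = f a ∨ f m = f b) ∧ (f s = f a ∨ f s = f b) := by
    intro m s hm hs
    obtain ⟨-, d, hd, hmd⟩ := id hm
    obtain ⟨-, d', hd', hsd⟩ := id hs
    obtain ⟨a, b, hab, hz⟩ := hpair d hd d' hd'
    exact ⟨a, b, hab, h.eq_end_of_mem hab (hYw m hm) (hz d (Or.inl rfl) m (Or.inr hmd.symm)),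
      h.eq_end_of_mem hab (hYw s hs) (hz d' (Or.inr rfl) s (Or.inr hsd.symm))⟩
  -- If `D` misses the interior of a long sector whose ends it sees, it is also anticomplete to that
  -- interior, being closed under adjacency; then `w`, the sector and `D` give a theta.
  have hmeet : ∀ i j, Sec G f w i j → i + 2 ≤ j → f i ∈ nbhd G D → f j ∈ nbhd G D →
      ∃ s, i < s ∧ s < j ∧ f s ∈ D := by
    intro i j hs hij hi hj
    by_contra hcon
    push Not at hcon
    obtain ⟨-, d, hd, hid⟩ := hi
    obtain ⟨-, d', hd', hjd⟩ := hj
    refine common_nbrs_false h.cls (h.ring.linearOn (h.sec_lt hs)) hij hs.2.1 hs.2.2.1 (X := D)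
      (fun m h1 h2 => ⟨(h.notMem m).symm, hs.2.2.2 m h1 h2⟩)
      (fun x hx => ⟨(hDw x hx).1.symm, fun e => (hDw x hx).2 e.symm⟩) ?_ ?_
    · intro m h1 h2 x hx
      refine ⟨fun e => hcon m h1 h2 (by rw [e]; exact hx), fun e => hcon m h1 h2 ?_⟩
      exact hDadj x hx _ e.symm (h.notMem m) (hs.2.2.2 m h1 h2)
    · have hsub : D ⊆ insert (f i) (insert (f j) D) := fun x hx => by simp [hx]
      exact (Reach.of_adj hid (by simp) (hsub hd)).trans
        (((hDreach d hd d' hd').mono hsub).trans (.of_adj hjd.symm (hsub hd') (by simp)))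
  by_contra hbad
  push Not at hbad
  obtain ⟨i₀, j₀, hs₀, -, -⟩ := h.exists_sec 0
  obtain ⟨m, hm, -⟩ := hbad i₀ j₀ hs₀
  have hwm := hYw m hm
  obtain ⟨l, hl⟩ := h.sec_of_nbr hwm
  obtain ⟨e, m', he, he1, he2⟩ := h.exists_sec (m - 1)
  obtain rfl : m' = m := by
    by_contra hne
    exact he.2.2.2 m (by omega) (by omega) hwm
  have hl1 := hl.1
  have he3 := he.1
  have hl2 := h.sec_lt hl
  have he4 := h.sec_lt he
  obtain ⟨s, hs, hsm, hsl⟩ := hbad _ _ hl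
  obtain ⟨t, ht, hte, htm⟩ := hbad _ _ he
  -- The only sectors with end `f m'` are `[e, m']` and `[m', l]`, so a vertex of N(D) missed by one
  -- is the other end of the second.
  have hse : f s = f e := by
    obtain ⟨a, b, hab, h1, h2⟩ := hends _ _ hm hs
    rcases h1 with h1 | h1
    · have := h.end_of_start hab hl h1
      rcases h2 with h2 | h2
      · exact absurd (h2.trans h1.symm) hsm
      · exact absurd (h2.trans this.symm) hsl
    · have := h.start_of_end hab he h1
      rcases h2 with h2 | h2
      · exact h2.trans this.symm
      · exact absurd (h2.trans h1.symm) hsm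
  have htl : f t = f l := by
    obtain ⟨a, b, hab, h1, h2⟩ := hends _ _ hm ht
    rcases h1 with h1 | h1
    · have := h.end_of_start hab hl h1
      rcases h2 with h2 | h2
      · exact absurd (h2.trans h1.symm) htm
      · exact h2.trans this.symm
    · have := h.start_of_end hab he h1
      rcases h2 with h2 | h2
      · exact absurd (h2.trans this.symm) hte
      · exact absurd (h2.trans h1.symm) htm
  rw [hse] at hs hsm hsl
  rw [htl] at ht htm
  have hle : l < e + N := by
    by_contra hc
    rcases eq_or_lt_of_le (show e + N ≤ l by omega) with h1 | h1
    · exact hsl (by rw [← h1, h.ring.per])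
    · refine hl.2.2.2 (e + N) (by omega) h1 ?_
      rw [h.ring.per]; exact he.2.1
  -- The ends `f e` and `f l` bound a common sector, which is neither of the two known ones; the
  -- three sectors therefore exhaust the hole.
  have hlast : Sec G f w l (e + N) := by
    obtain ⟨c, hc⟩ := h.sec_of_nbr hl.2.2.1
    obtain ⟨a, b, hab, h1, h2⟩ := hends _ _ hs ht
    have hce : f c = f e := by
      rcases h2 with h2 | h2
      · rcases h1 with h1 | h1
        · exact absurd (h1.trans h2.symm) hsl
        · rw [h.end_of_start hab hc h2, h1]
      · rcases h1 with h1 | h1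
        · exact absurd (h2.trans (h.end_of_start hab he h1).symm) htm
        · exact absurd (h1.trans h2.symm) hsl
    have hc1 := hc.1
    have hc2 := h.sec_lt hc
    have := h.ring.inj (c := l) hc1.le (by omega) hle.le (by omega)
      (hce.trans (h.ring.per e).symm)
    rwa [this] at hc
  have hK : (G.neighborSet w ∩ Set.range f).ncard = 3 := by
    have h3 := h.three_le
    by_contra hne
    obtain ⟨r, h1, h2, h5, h6⟩ := h.exists_notMem e {e, m', l}
      (lt_of_le_of_lt Finset.card_le_three (by omega))
    simp only [Finset.mem_insert, Finset.mem_singleton, not_or] at h6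
    rcases lt_or_gt_of_ne h6.2.1 with h7 | h7
    · exact he.2.2.2 r (by omega) h7 h5
    rcases lt_or_gt_of_ne h6.2.2 with h8 | h8
    · exact hl.2.2.2 r h7 h8 h5
    · exact hlast.2.2.2 r h8 h2 h5
  have hem : e + 2 ≤ m' := by
    by_contra hc
    exact h.spread hK e he.2.1 (by rw [show e + 1 = m' by omega]; exact hwm)
  have hml : m' + 2 ≤ l := by
    by_contra hc
    exact h.spread hK m' hwm (by rw [show m' + 1 = l by omega]; exact hl.2.2.1)
  obtain ⟨s₁, h1, h2, hs₁⟩ := hmeet e m' he hem hs hm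
  obtain ⟨s₂, h3, h4, hs₂⟩ := hmeet m' l hl hml hm ht
  -- The vertices `f s₁` and `f s₂` of `D` are interior to two different sectors, yet `hpair` puts
  -- them in one; here it matters that hole vertices inside `D` count as attachments.
  obtain ⟨a, b, hab, hz⟩ := hpair _ hs₁ _ hs₂
  have hz₁ := hz _ (Or.inl rfl) s₁ (Or.inl rfl)
  have hz₂ := hz _ (Or.inr rfl) s₂ (Or.inl rfl)
  obtain ⟨k, hk⟩ := h.mem_sector_normalize he hab
  rw [← h.ring.image_Icc_shift a b k] at hz₁ hz₂
  rcases hk with ⟨hk1, hk2⟩ | ⟨hk1, hk2⟩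
  · rw [hk1, hk2] at hz₂
    have := h.ring.mem_Icc_of_mem_image (c := e) le_rfl (by omega) (by omega) (by omega) hz₂
    omega
  · have := h.ring.mem_Icc_of_mem_image (c := e + 1) (by omega) (by omega) (by omega) (by omega) hz₁
    omega

end Wheel

end SepGraph

theorem theorem3 {V : Type*} [Finite V] (G : SimpleGraph V) (hG : SepGraph.InClassC G)
    (H : Set V) (hH : SepGraph.IsHole G H) (w : V) (hw : SepGraph.IsMajor G H w)
    (D : G.ComponentCompl (SepGraph.closedNbhd G w)) :
    ∃ (x y : V) (P : G.Walk x y), SepGraph.IsSector H w P ∧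
      SepGraph.nbhd G (SimpleGraph.ComponentCompl.supp D) ⊆ {x, y} ∪ (G.neighborSet w \ H) := by
  obtain ⟨f, N, hf, rfl⟩ := hH.exists_ring
  have h := SepGraph.wheel_of_major hG hf hw
  have hDw : ∀ x ∈ D.supp, x ≠ w ∧ ¬ G.Adj x w := by
    rintro x ⟨hx, -⟩
    rw [SepGraph.closedNbhd, Set.mem_insert_iff, not_or, SimpleGraph.mem_neighborSet] at hx
    exact ⟨hx.1, fun e => hx.2 e.symm⟩
  have hDadj : ∀ x ∈ D.supp, ∀ y, G.Adj x y → y ≠ w → ¬ G.Adj w y → y ∈ D.supp := by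
    intro x hx y hxy hyw hwy
    refine SimpleGraph.ComponentCompl.mem_of_adj x y hx ?_ hxy
    rintro (e | e)
    exacts [hyw e, hwy e]
  obtain ⟨i, j, hs, hD⟩ := h.exists_sector hDw hDadj
    fun x hx y hy => SepGraph.reach_of_mem_component D hx hy
  obtain ⟨P, hP, hl, hPs⟩ := (hf.linearOn (h.sec_lt hs)).exists_walk hs.1.le
  have hij := hs.1
  refine ⟨f i, f j, P, ⟨⟨hP, fun v hv => ?_⟩, by omega, hs.2.1, hs.2.2.1, ?_⟩, ?_⟩
  · obtain ⟨m, -, -, rfl⟩ := (hPs v).1 hv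
    exact ⟨m, rfl⟩
  · intro v hv hvi hvj
    obtain ⟨m, h1, h2, rfl⟩ := (hPs v).1 hv
    refine hs.2.2.2 m (lt_of_le_of_ne h1 ?_) (lt_of_le_of_ne h2 ?_)
    · rintro rfl; exact hvi rfl
    · rintro rfl; exact hvj rfl
  · intro v hv
    by_cases hvH : v ∈ Set.range f
    · obtain ⟨m, rfl⟩ := hvH
      exact Or.inl (hD m hv)
    -- A vertex of N(D) not adjacent to `w` would differ from `w` and be absorbed by the component
    -- `D`.
    · refine Or.inr ⟨?_, hvH⟩
      obtain ⟨hvD, d, hd, hvd⟩ := hv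
      rw [SimpleGraph.mem_neighborSet]
      by_contra hwv
      refine hvD (hDadj d hd v hvd.symm ?_ hwv)
      rintro rfl
      exact (hDw d hd).2 hvd.symm
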